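/- Let $\mathbf{Vect}$ be the category of finite dimensional real vector spaces and linear maps; every space of linear maps $\hom(V,W)$ has its standard topology. A structure category $\mathcal V$ is a (not necessarily full) subcategory of $\mathbf{Vect}$; it is closed if all $\hom_{\mathcal V}(V,W)$ are closed in $\hom(V,W)$. Its closure $\bar{\mathcal V}$ has the same objects and the closures of the hom-sets as hom-sets. A functor $\psi\colon\mathcal V\to\mathcal W$ is continuous if all maps $\hom_{\mathcal V}(V_1,V_2)\to\hom_{\mathcal W}(\psi V_1,\psi V_2)$ are continuous; a continuous $\psi$ is regular if it is the restriction of a continuous functor $\bar{\mathcal V}\to\bar{\mathcal W}$. A $\mathcal V$-family is a continuous map $p\colon X\to\bar X$ with, for each $b\in\bar X$, an object $X_b$ of $\mathcal V$ and a homeomorphism (chart) $p^{-1}(b)\approx X_b$. A $\mathcal V$-map $X\to Y$ is a pair of continuous maps $f\colon X\to Y$, $\bar f\colon \bar X\to\bar Y$ commuting with the projections and such that each $X_b\to Y_{\bar f(b)}$ (read in the charts) is a morphism of $\mathcal V$. For $V\in\mathcal V$, $X^V$ is the space of all $\mathcal V$-maps from $V$ (as a family over a point) to $X$, with the compact-open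 topology. A $\mathcal V$-set is a $\mathcal V$-family with discrete base. A $\mathcal V$-complex is a $\mathcal V$-family $X\to\bar X$ with a filtration $\emptyset=\bar X_{-1}\subseteq\bar X_0\subseteq\bar X_1\subseteq\dots$, $\bigcup_n\bar X_n=\bar X$, together with, for each $n\ge 0$, a $\mathcal V$-set $Z_n$ and a $\mathcal V$-map (characteristic map) $\Phi_n\colon Z_n\times D^n\to X$ into $X_n=X|\bar X_n$ whose restriction $h_n$ to $Z_n\times S^{n-1}$ has values in $X_{n-1}$, such that $X_n$ is the push-out of $Z_n\times D^n\hookleftarrow Z_n\times S^{n-1}\xrightarrow{h_n}X_{n-1}$ in the category of $\mathcal V$-families and $\mathcal V$-maps, and such that $X$ and $\bar X$ have the limit (weak) topology of $(X_n)$ and $(\bar X_n)$. Let $\mathcal V\text{-}\mathbf{CW}$ be the category of $\mathcal V$-complexes and all $\mathcal V$-maps between them. Let $\mathcal V$, $\mathcal W$ be structure categories and $\psi\colon\mathcal V\to\mathcal W$ a continuous functor. For a $\mathcal V$-complex $X$ let $\psi X=\coprod_{b\in\bar X}\psi(X_b)$, with the evident projection to $\bar X$ and charts, and let $\psi X_n$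 be the part over $\bar X_n$. Topologize $\psi X_n$ by induction on $n$: starting from $\psi X_{-1}=\emptyset$, the set $\psi X_n$ has the finest topology for which $\psi X_{n-1}\to\psi X_n$ and the map $\psi(\Phi_n)\colon\psi(Z_n)\times D^n\to\psi X_n$ obtained by applying $\psi$ to $\Phi_n$ fibre by fibre are continuous; and give $\psi X$ the limit topology of the $\psi X_n$. For a $\mathcal V$-map $f\colon X\to Y$ let $\psi(f)\colon\psi X\to\psi Y$ be the map over $\bar f$ obtained by applying $\psi$ to $X_b\to Y_{\bar f(b)}$ for each $b$. Assume that $\mathcal V$ and $\mathcal W$ are closed, or that $\psi$ is regular. Then: 1. For every $\mathcal V$-complex $X$, $\psi X\to\bar X$, with the skeleta $\bar X_n$, the $\mathcal W$-sets $\psi(Z_n)$ and the characteristic maps $\psi(\Phi_n)$, is a $\mathcal W$-complex; in particular, $\psi X_n$ is the push-out of $\psi(Z_n)\times D^n\hookleftarrow\psi(Z_n)\times S^{n-1}\xrightarrow{\psi(h_n)}\psi X_{n-1}$. The inductively defined topology of $\psi X_n$ is the subspace topology from $\psi X$. 2. For every $\mathcal V$-map $f\colon X\to Y$ of $\mathcal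 V$-complexes, $\psi(f)$ is continuous, hence a $\mathcal W$-map, and $X\mapsto\psi X$, $f\mapsto\psi(f)$ is a functor $\mathcal V\text{-}\mathbf{CW}\to\mathcal W\text{-}\mathbf{CW}$. 3. For every $\mathcal V$-complex $X$ and every $V\in\mathcal V$, the map $\psi^V\colon X^V\to(\psi X)^{\psi V}$ that sends $a\colon V\to X_b\subseteq X$ to $\psi(a)\colon\psi(V)\to\psi(X_b)\subseteq\psi X$ is continuous. -/

import Mathlib

open CategoryTheory Topology

universe u

/-! ## Finite dimensional real vector spaces and structure categories -/

/-- The standard topology of a finite dimensional real vector space. -/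
instance FGModuleCat.realTopology (V : FGModuleCat.{u} ℝ) : TopologicalSpace V :=
  moduleTopology ℝ V

instance (V : FGModuleCat.{u} ℝ) : IsModuleTopology ℝ V := ⟨rfl⟩

instance (V : FGModuleCat.{u} ℝ) : ContinuousAdd V := IsModuleTopology.toContinuousAdd ℝ V

instance (V : FGModuleCat.{u} ℝ) : ContinuousSMul ℝ V := IsModuleTopology.toContinuousSMul ℝ V

/-- A structure category: a (not necessarily full) subcategory of the category of finite
dimensional real vector spaces and linear maps. -/
structure StructureCategory where
  /-- the objects -/
  obj : Set (FGModuleCat.{u} ℝ)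
  /-- the morphisms -/
  hom : ∀ V W : obj, Set (V.1 →ₗ[ℝ] W.1)
  id_mem : ∀ V : obj, LinearMap.id ∈ hom V V
  comp_mem : ∀ {U V W : obj} {f : U.1 →ₗ[ℝ] V.1} {g : V.1 →ₗ[ℝ] W.1},
    f ∈ hom U V → g ∈ hom V W → g ∘ₗ f ∈ hom U W

namespace StructureCategory

/-- The type of objects of a structure category. -/
structure Obj (𝒱 : StructureCategory.{u}) where
  /-- the underlying object of the category of vector spaces together with its membership -/
  toObj : 𝒱.obj

variable {𝒱 : StructureCategory.{u}}

/-- The underlying vector space. -/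
abbrev Obj.vect (V : 𝒱.Obj) : FGModuleCat.{u} ℝ := V.toObj.1

instance : CoeSort 𝒱.Obj (Type u) := ⟨fun V => V.vect⟩

instance : Category 𝒱.Obj where
  Hom V W := {f : V.vect →ₗ[ℝ] W.vect // f ∈ 𝒱.hom V.toObj W.toObj}
  id V := ⟨LinearMap.id, 𝒱.id_mem V.toObj⟩
  comp f g := ⟨g.1 ∘ₗ f.1, 𝒱.comp_mem f.2 g.2⟩

/-- The linear map underlying a morphism of the structure category. -/
def lin {V W : 𝒱.Obj} (m : V ⟶ W) : V.vect →ₗ[ℝ] W.vect := m.1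

@[simp] theorem lin_id (V : 𝒱.Obj) : lin (𝟙 V) = LinearMap.id := rfl

@[simp] theorem lin_comp {U V W : 𝒱.Obj} (f : U ⟶ V) (g : V ⟶ W) :
    lin (f ≫ g) = lin g ∘ₗ lin f := rfl

theorem lin_injective {V W : 𝒱.Obj} {f g : V ⟶ W} (h : lin f = lin g) : f = g :=
  Subtype.ext h

/-- Hom-sets carry the subspace topology of the space of all linear maps. -/
instance homTopology (V W : 𝒱.Obj) : TopologicalSpace (V ⟶ W) :=
  (moduleTopology ℝ (V.vect →ₗ[ℝ] W.vect)).induced lin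

/-- A closed subcategory: every hom-set is closed in the space of all linear maps. -/
def IsClosedSubcategory (𝒱 : StructureCategory.{u}) : Prop :=
  ∀ V W : 𝒱.obj, IsClosed[moduleTopology ℝ (V.1 →ₗ[ℝ] W.1)] (𝒱.hom V W)

theorem comp_mem_closure {U V W : FGModuleCat.{u} ℝ} {s : Set (U →ₗ[ℝ] V)}
    {t : Set (V →ₗ[ℝ] W)} {r : Set (U →ₗ[ℝ] W)}
    (hst : ∀ f ∈ s, ∀ g ∈ t, g ∘ₗ f ∈ r) {f : U →ₗ[ℝ] V} {g : V →ₗ[ℝ] W}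
    (hf : f ∈ @closure _ (moduleTopology ℝ (U →ₗ[ℝ] V)) s)
    (hg : g ∈ @closure _ (moduleTopology ℝ (V →ₗ[ℝ] W)) t) :
    g ∘ₗ f ∈ @closure _ (moduleTopology ℝ (U →ₗ[ℝ] W)) r := by
  let _ : TopologicalSpace (U →ₗ[ℝ] V) := moduleTopology ℝ _
  let _ : TopologicalSpace (V →ₗ[ℝ] W) := moduleTopology ℝ _
  let _ : TopologicalSpace (U →ₗ[ℝ] W) := moduleTopology ℝ _
  have : IsModuleTopology ℝ (U →ₗ[ℝ] V) := ⟨rfl⟩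
  have : IsModuleTopology ℝ (V →ₗ[ℝ] W) := ⟨rfl⟩
  have : IsModuleTopology ℝ (U →ₗ[ℝ] W) := ⟨rfl⟩
  have : ContinuousAdd (U →ₗ[ℝ] W) := IsModuleTopology.toContinuousAdd ℝ _
  have : ContinuousSMul ℝ (U →ₗ[ℝ] W) := IsModuleTopology.toContinuousSMul ℝ _
  have hc := IsModuleTopology.continuous_bilinear_of_finite_left
    (LinearMap.mk₂ ℝ (fun (f : U →ₗ[ℝ] V) (g : V →ₗ[ℝ] W) => g ∘ₗ f)
      (fun f f' g => LinearMap.comp_add f f' g) (fun c f g => LinearMap.comp_smul g c f)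
      (fun f g g' => LinearMap.add_comp f g' g) (fun c f g => LinearMap.smul_comp c g f))
  exact map_mem_closure₂ (f := fun (f : U →ₗ[ℝ] V) (g : V →ₗ[ℝ] W) => g ∘ₗ f)
    hc hf hg hst

/-- The closure of a structure category: the same objects, and the closures of the hom-sets. -/
def closureCat (𝒱 : StructureCategory.{u}) : StructureCategory.{u} where
  obj := 𝒱.obj
  hom V W := @closure _ (moduleTopology ℝ (V.1 →ₗ[ℝ] W.1)) (𝒱.hom V W)
  id_mem V := @subset_closure _ (moduleTopology ℝ (V.1 →ₗ[ℝ] V.1)) _ _ (𝒱.id_mem V)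
  comp_mem hf hg := comp_mem_closure (fun _ h _ h' => 𝒱.comp_mem h h') hf hg

/-- The inclusion functor of a structure category into its closure. -/
def toClosure (𝒱 : StructureCategory.{u}) : 𝒱.Obj ⥤ 𝒱.closureCat.Obj where
  obj V := ⟨V.toObj⟩
  map {V W} m := ⟨m.1,
    @subset_closure _ (moduleTopology ℝ (V.vect →ₗ[ℝ] W.vect)) _ _ m.2⟩

/-- A functor of structure categories is continuous if it is continuous on all hom-spaces. -/
def IsContinuousFunctor {𝒱 𝒲 : StructureCategory.{u}} (ψ : 𝒱.Obj ⥤ 𝒲.Obj) : Prop :=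
  ∀ V₁ V₂ : 𝒱.Obj, Continuous (fun m : V₁ ⟶ V₂ => ψ.map m)

/-- A functor `ψ : 𝒱 ⥤ 𝒲` is regular if it is the restriction of a continuous functor between
the closures of `𝒱` and `𝒲`. -/
def IsRegularFunctor {𝒱 𝒲 : StructureCategory.{u}} (ψ : 𝒱.Obj ⥤ 𝒲.Obj) : Prop :=
  ∃ ψ' : 𝒱.closureCat.Obj ⥤ 𝒲.closureCat.Obj,
    IsContinuousFunctor ψ' ∧ ψ ⋙ 𝒲.toClosure = 𝒱.toClosure ⋙ ψ'

end StructureCategory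

open StructureCategory

/-! ## Families of vector spaces -/

/-- The data of a family of vector spaces in `𝒱`: total space, base space, projection, an object
of `𝒱` for every point of the base, and a bijective chart on every fibre. The continuity
conditions are in `PreFamily.IsFamily`. -/
structure PreFamily (𝒱 : StructureCategory.{u}) where
  Total : Type u
  Base : Type u
  [topTotal : TopologicalSpace Total]
  [topBase : TopologicalSpace Base]
  proj : Total → Base
  fiber : Base → 𝒱.Obj
  chart : ∀ b : Base, {x : Total // proj x = b} ≃ fiber b

attribute [instance] PreFamily.topTotal PreFamily.topBase

/-- The data form a family of vector spaces: the projection is continuous and the charts are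
homeomorphisms. -/
structure PreFamily.IsFamily {𝒱 : StructureCategory.{u}} (X : PreFamily 𝒱) : Prop where
  continuous_proj : Continuous X.proj
  isHomeomorph_chart : ∀ b, IsHomeomorph (X.chart b)

/-- A family of vector spaces in `𝒱` (a `𝒱`-family). -/
structure VFamily (𝒱 : StructureCategory.{u}) extends PreFamily 𝒱 where
  isFamily : toPreFamily.IsFamily

variable {𝒱 𝒲 : StructureCategory.{u}}

/-- A pair of functions on total spaces and base spaces that commutes with the projections and
that, read in the charts, is a morphism of `𝒱` on every fibre. No continuity is required. -/
@[ext]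
structure PreMap (X Y : PreFamily 𝒱) where
  toFun : X.Total → Y.Total
  base : X.Base → Y.Base
  comm : ∀ x, Y.proj (toFun x) = base (X.proj x)
  fiber_mem : ∀ b : X.Base, ∃ m : X.fiber b ⟶ Y.fiber (base b),
    ∀ x : {x : X.Total // X.proj x = b},
      Y.chart (base b) ⟨toFun x.1, (comm x.1).trans (congrArg base x.2)⟩ = lin m (X.chart b x)

/-- Continuity of a pair of functions between families. -/
structure PreMap.IsContinuous {X Y : PreFamily 𝒱} (f : PreMap X Y) : Prop where
  continuous_toFun : Continuous f.toFun
  continuous_base : Continuous f.base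

/-- A `𝒱`-map of `𝒱`-families. -/
@[ext]
structure VMap (X Y : VFamily 𝒱) extends PreMap X.toPreFamily Y.toPreFamily where
  isContinuous : toPreMap.IsContinuous

namespace PreMap

variable {X Y Z : PreFamily 𝒱}

/-- The morphism of `𝒱` that a map of families induces on the fibre over `b`. -/
noncomputable def fiberMap (f : PreMap X Y) (b : X.Base) : X.fiber b ⟶ Y.fiber (f.base b) :=
  (f.fiber_mem b).choose

theorem chart_toFun (f : PreMap X Y) (b : X.Base) (x : {x : X.Total // X.proj x = b}) :
    Y.chart (f.base b) ⟨f.toFun x.1, (f.comm x.1).trans (congrArg f.base x.2)⟩ =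
      lin (f.fiberMap b) (X.chart b x) :=
  (f.fiber_mem b).choose_spec x

/-- The identity. -/
def id (X : PreFamily 𝒱) : PreMap X X where
  toFun x := x
  base b := b
  comm _ := rfl
  fiber_mem _ := ⟨𝟙 _, fun _ => rfl⟩

/-- Composition. -/
def comp (f : PreMap X Y) (g : PreMap Y Z) : PreMap X Z where
  toFun x := g.toFun (f.toFun x)
  base b := g.base (f.base b)
  comm x := by rw [g.comm, f.comm]
  fiber_mem b := ⟨f.fiberMap b ≫ g.fiberMap (f.base b), fun x => by
    have h := g.chart_toFun (f.base b)
      ⟨f.toFun x.1, (f.comm x.1).trans (congrArg f.base x.2)⟩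
    rw [f.chart_toFun] at h
    exact h⟩

end PreMap

/-- The category of `𝒱`-families and `𝒱`-maps. -/
instance : Category (VFamily 𝒱) where
  Hom X Y := VMap X Y
  id X := ⟨PreMap.id _, ⟨continuous_id, continuous_id⟩⟩
  comp f g := ⟨f.toPreMap.comp g.toPreMap,
    ⟨g.isContinuous.1.comp f.isContinuous.1, g.isContinuous.2.comp f.isContinuous.2⟩⟩

namespace VFamily

/-- The restriction of a family to a subspace of the base. -/
def restrictPre (X : PreFamily 𝒱) (S : Set X.Base) : PreFamily 𝒱 where
  Total := {x : X.Total // X.proj x ∈ S}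
  Base := S
  proj x := ⟨X.proj x.1, x.2⟩
  fiber b := X.fiber b.1
  chart b :=
    { toFun := fun x => X.chart b.1 ⟨x.1.1, congrArg Subtype.val x.2⟩
      invFun := fun v => ⟨⟨((X.chart b.1).symm v).1, by
        rw [((X.chart b.1).symm v).2]; exact b.2⟩, Subtype.ext ((X.chart b.1).symm v).2⟩
      left_inv := fun x => by simp
      right_inv := fun v => by simp }

theorem restrictPre_isFamily {X : PreFamily 𝒱} (hX : X.IsFamily) (S : Set X.Base) :
    (restrictPre X S).IsFamily where
  continuous_proj := by
    have := hX.continuous_proj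
    exact Continuous.subtype_mk (this.comp continuous_subtype_val) _
  isHomeomorph_chart b := by
    have h := hX.isHomeomorph_chart b.1
    have hs : Continuous (X.chart b.1).symm :=
      ((X.chart b.1).toHomeomorphOfIsInducing h.isInducing).symm.continuous
    have h0 : Continuous (fun x : {x : (restrictPre X S).Total // (restrictPre X S).proj x = b} =>
        (x.1.1 : X.Total)) := Continuous.comp (g := fun y : (restrictPre X S).Total => y.1)
      continuous_subtype_val continuous_subtype_val
    have h1 : Continuous (fun x : {x : (restrictPre X S).Total // (restrictPre X S).proj x = b} =>
        (⟨x.1.1, congrArg Subtype.val x.2⟩ : {x : X.Total // X.proj x = b.1})) :=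
      continuous_induced_rng.2 h0
    have h2 : Continuous (fun v => ((X.chart b.1).symm v).1) := continuous_subtype_val.comp hs
    exact Homeomorph.isHomeomorph (Homeomorph.mk ((restrictPre X S).chart b)
      (h.continuous.comp h1) (continuous_induced_rng.2 (continuous_induced_rng.2 h2)))

/-- The restriction `X | S` of a `𝒱`-family to a subspace `S` of its base. -/
def restrict (X : VFamily 𝒱) (S : Set X.Base) : VFamily 𝒱 where
  toPreFamily := restrictPre X.toPreFamily S
  isFamily := restrictPre_isFamily X.isFamily S

/-- The inclusion of a restriction. -/
def restrictι (X : VFamily 𝒱) (S : Set X.Base) : X.restrict S ⟶ X where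
  toFun x := x.1
  base b := b.1
  comm _ := rfl
  fiber_mem _ := ⟨𝟙 _, fun _ => rfl⟩
  isContinuous := ⟨continuous_subtype_val, continuous_subtype_val⟩

/-- A `𝒱`-map whose base map has values in `S`, as a map into the restriction to `S`. -/
def lift {A X : VFamily 𝒱} (f : A ⟶ X) (S : Set X.Base) (h : ∀ b, f.base b ∈ S) :
    A ⟶ X.restrict S where
  toFun x := ⟨f.toFun x, Set.mem_of_eq_of_mem (f.comm x) (h _)⟩
  base b := ⟨f.base b, h b⟩
  comm x := Subtype.ext (f.comm x)
  fiber_mem b := f.fiber_mem b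
  isContinuous := ⟨Continuous.subtype_mk f.isContinuous.1 _,
    Continuous.subtype_mk f.isContinuous.2 _⟩

/-- The inclusion `X | S ⟶ X | T` for `S ⊆ T`. -/
def restrictLE (X : VFamily 𝒱) {S T : Set X.Base} (h : S ⊆ T) : X.restrict S ⟶ X.restrict T :=
  lift (X.restrictι S) T (fun b => h b.2)

/-- The data of `Z × E`, where `Z` is the `𝒱`-set with fibres `V c`, `c ∈ C`, and `E` is a
space. The base is the product of `E` with the discrete space `C`. -/
def cellsPre {C : Type u} (V : C → 𝒱.Obj) (E : Type) [TopologicalSpace E] : PreFamily 𝒱 where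
  Total := Σ c : C, E × V c
  Base := Σ _ : C, E
  proj x := ⟨x.1, x.2.1⟩
  fiber b := V b.1
  chart b :=
    { toFun := fun x => cast (congrArg (fun p : (Σ _ : C, E) => (V p.1 : Type u)) x.2) x.1.2.2
      invFun := fun v => ⟨⟨b.1, b.2, v⟩, rfl⟩
      left_inv := by rintro ⟨⟨c, e, v⟩, rfl⟩; rfl
      right_inv := fun v => rfl }

theorem cellsPre_isFamily {C : Type u} (V : C → 𝒱.Obj) (E : Type) [TopologicalSpace E] :
    (cellsPre V E).IsFamily where
  continuous_proj := continuous_sigma fun c =>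
    (continuous_sigmaMk (σ := fun _ : C => E)).comp continuous_fst
  isHomeomorph_chart := by
    rintro ⟨c, e⟩
    have hinv : IsEmbedding ((cellsPre V E).chart ⟨c, e⟩).symm := by
      refine IsEmbedding.of_comp (g := Subtype.val) ?_ continuous_subtype_val ?_
      · exact Continuous.subtype_mk
          ((continuous_sigmaMk (σ := fun c : C => E × V c)).comp (Continuous.prodMk_right e)) _
      · exact (IsEmbedding.sigmaMk (σ := fun c : C => E × V c)).comp (isEmbedding_prodMkRight e)
    exact (((cellsPre V E).chart ⟨c, e⟩).symm.toHomeomorphOfIsInducing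
      hinv.isInducing).symm.isHomeomorph

/-- The `𝒱`-family `Z × E`, where `Z` is the `𝒱`-set with fibres `V c`, `c ∈ C`. -/
def cells {C : Type u} (V : C → 𝒱.Obj) (E : Type) [TopologicalSpace E] : VFamily 𝒱 where
  toPreFamily := cellsPre V E
  isFamily := cellsPre_isFamily V E

/-- The map `Z × E ⟶ Z × E'` induced by a continuous map `E → E'`. -/
def cellsMap {C : Type u} (V : C → 𝒱.Obj) {E E' : Type} [TopologicalSpace E]
    [TopologicalSpace E'] (g : C(E, E')) : cells V E ⟶ cells V E' where
  toFun x := ⟨x.1, g x.2.1, x.2.2⟩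
  base b := ⟨b.1, g b.2⟩
  comm _ := rfl
  fiber_mem b := ⟨𝟙 (V b.1), by rintro ⟨⟨c, e, v⟩, rfl⟩; rfl⟩
  isContinuous :=
    { continuous_toFun := continuous_sigma fun c =>
        (continuous_sigmaMk (σ := fun c : C => E' × V c)).comp
          ((g.continuous.comp continuous_fst).prodMk continuous_snd)
      continuous_base := continuous_sigma fun c =>
        (continuous_sigmaMk (σ := fun _ : C => E')).comp g.continuous }

/-- An object `V` of `𝒱` as a family over a point. -/
def point (V : 𝒱.Obj) : VFamily 𝒱 where
  Total := V
  Base := PUnit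
  proj _ := PUnit.unit
  fiber _ := V
  chart _ := Equiv.subtypeUnivEquiv fun _ => rfl
  isFamily :=
    { continuous_proj := continuous_const
      isHomeomorph_chart := fun _ => Homeomorph.isHomeomorph
        ⟨Equiv.subtypeUnivEquiv fun _ => rfl, continuous_subtype_val,
          Continuous.subtype_mk continuous_id _⟩ }

end VFamily

/-- The function space `Y^V` of all `𝒱`-maps from `V` (over a point) to `Y`. -/
def FunSpace (V : 𝒱.Obj) (Y : VFamily 𝒱) : Type u := VFamily.point V ⟶ Y

/-- The continuous map of total spaces underlying an element of `Y^V`. -/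
def FunSpace.toContinuousMap {V : 𝒱.Obj} {Y : VFamily 𝒱} (a : FunSpace V Y) : C(V, Y.Total) :=
  ⟨VMap.toPreMap a |>.toFun, VMap.isContinuous a |>.continuous_toFun⟩

/-- The function space `Y^V` carries the compact-open topology. -/
instance (V : 𝒱.Obj) (Y : VFamily 𝒱) : TopologicalSpace (FunSpace V Y) :=
  TopologicalSpace.induced FunSpace.toContinuousMap inferInstance

/-! ## Complexes -/

/-- The closed unit disk `D^n`. -/
abbrev Disk (n : ℕ) : Type := Metric.closedBall (0 : EuclideanSpace ℝ (Fin n)) 1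

/-- The unit sphere `S^(n-1)`, the boundary of `D^n`; it is empty for `n = 0`. -/
abbrev BdSphere (n : ℕ) : Type := Metric.sphere (0 : EuclideanSpace ℝ (Fin n)) 1

/-- The inclusion of the boundary sphere in the disk. -/
def bdIncl (n : ℕ) : C(BdSphere n, Disk n) where
  toFun := Set.inclusion Metric.sphere_subset_closedBall
  continuous_toFun := continuous_inclusion _

/-- The data of a cell decomposition of a family: a filtration of the base, the `𝒱`-sets of
cells, and characteristic maps. Here `skel n` is the `(n-1)`-skeleton: `skel 0` will be empty and
`skel (n + 1)` arises from `skel n` by attaching the `n`-cells. -/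
structure PreCells (X : PreFamily 𝒱) where
  skel : ℕ → Set X.Base
  Cell : ℕ → Type u
  cellFiber : ∀ n, Cell n → 𝒱.Obj
  char : ∀ n, PreMap (VFamily.cells (cellFiber n) (Disk n)).toPreFamily X

/-- The data make `X` a `𝒱`-complex: `X` is a `𝒱`-family, the skeleta increase from the empty set
and exhaust `X`, the restriction of `X` to the `n`-skeleton is the push-out, in the category of
`𝒱`-families, of `Z_n × D^n ← Z_n × S^(n-1) → (n-1)-skeleton`, and `X` has the topology of the
union of its skeleta. -/
structure PreCells.IsComplex {X : PreFamily 𝒱} (K : PreCells X) : Prop where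
  isFamily : X.IsFamily
  skel_zero : K.skel 0 = ∅
  skel_succ : ∀ n, K.skel n ⊆ K.skel (n + 1)
  iUnion_skel : ⋃ n, K.skel n = Set.univ
  char_continuous : ∀ n, (K.char n).IsContinuous
  char_mem : ∀ n b, (K.char n).base b ∈ K.skel (n + 1)
  attach_mem : ∀ n b, (K.char n).base
    ((VFamily.cellsMap (K.cellFiber n) (bdIncl n)).base b) ∈ K.skel n
  isPushout : ∀ n,
    let X' : VFamily 𝒱 := ⟨X, isFamily⟩
    let Φ : VFamily.cells (K.cellFiber n) (Disk n) ⟶ X' := ⟨K.char n, char_continuous n⟩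
    let i := VFamily.cellsMap (K.cellFiber n) (bdIncl n)
    IsPushout (VFamily.lift (i ≫ Φ) (K.skel n) (attach_mem n)) i
      (X'.restrictLE (skel_succ n)) (VFamily.lift Φ (K.skel (n + 1)) (char_mem n))
  isClosed_base : ∀ S : Set X.Base,
    (∀ n, IsClosed (Subtype.val ⁻¹' S : Set (K.skel n))) → IsClosed S
  isClosed_total : ∀ S : Set X.Total,
    (∀ n, IsClosed (Subtype.val ⁻¹' S : Set {x : X.Total // X.proj x ∈ K.skel n})) → IsClosed S

/-- A `𝒱`-complex. -/
structure VComplex (𝒱 : StructureCategory.{u}) extends PreFamily 𝒱 where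
  cells : PreCells toPreFamily
  isComplex : cells.IsComplex

/-- The underlying `𝒱`-family of a `𝒱`-complex. -/
def VComplex.toVFamily (X : VComplex 𝒱) : VFamily 𝒱 := ⟨X.toPreFamily, X.isComplex.isFamily⟩

/-- The category of `𝒱`-complexes; its morphisms are all `𝒱`-maps. -/
instance : Category (VComplex 𝒱) where
  Hom X Y := X.toVFamily ⟶ Y.toVFamily
  id X := 𝟙 X.toVFamily
  comp f g := CategoryStruct.comp (obj := VFamily 𝒱) f g

/-! ## The construction `ψX` -/

section Psi

variable (ψ : 𝒱.Obj ⥤ 𝒲.Obj)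

/-- The set `ψX`, the disjoint union of the vector spaces `ψ(X_b)`, `b` in the base of `X`. -/
def PsiTotal (X : PreFamily 𝒱) : Type u := Σ b : X.Base, ψ.obj (X.fiber b)

/-- The function `ψA → ψX` induced by a map `A → X`; over `b` it is `ψ` of the morphism
`A_b → X_{f b}`. -/
noncomputable def psiFun {A X : PreFamily 𝒱} (f : PreMap A X) :
    PsiTotal ψ A → PsiTotal ψ X :=
  fun x => ⟨f.base x.1, lin (ψ.map (f.fiberMap x.1)) x.2⟩

variable (X : VComplex 𝒱)

/-- The part of the set `ψX` over the skeleton `skel n`. -/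
def PsiSkel (n : ℕ) : Type u :=
  {x : PsiTotal ψ X.toPreFamily // x.1 ∈ X.cells.skel n}

/-- The inclusion of consecutive skeleta of `ψX`. -/
def psiSkelIncl (n : ℕ) : PsiSkel ψ X n → PsiSkel ψ X (n + 1) :=
  fun x => ⟨x.1, X.isComplex.skel_succ n x.2⟩

/-- The function `ψ(Z_n) × D^n → ψX` induced by the characteristic map `Z_n × D^n → X`. -/
noncomputable def psiCharFun (n : ℕ) :
    (VFamily.cells (fun c => ψ.obj (X.cells.cellFiber n c)) (Disk n)).Total →
      PsiTotal ψ X.toPreFamily :=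
  fun x => psiFun ψ (X.cells.char n) ⟨⟨x.1, x.2.1⟩, x.2.2⟩

/-- `psiCharFun` as a function into the `n`-skeleton. -/
noncomputable def psiCharSkel (n : ℕ) :
    (VFamily.cells (fun c => ψ.obj (X.cells.cellFiber n c)) (Disk n)).Total →
      PsiSkel ψ X (n + 1) :=
  fun x => ⟨psiCharFun ψ X n x, X.isComplex.char_mem n _⟩

/-- The topology of the skeleta of `ψX`, by induction: the `n`-skeleton has the push-out topology,
the finest one for which the maps from the `(n-1)`-skeleton and from `ψ(Z_n) × D^n` are
continuous. -/
@[reducible] noncomputable def psiSkelTop : ∀ n : ℕ, TopologicalSpace (PsiSkel ψ X n)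
  | 0 => ⊥
  | n + 1 => (psiSkelTop n).coinduced (psiSkelIncl ψ X n) ⊔
      TopologicalSpace.coinduced (psiCharSkel ψ X n) inferInstance

/-- The topology of `ψX`: the limit topology of its skeleta. -/
noncomputable instance psiTop : TopologicalSpace (PsiTotal ψ X.toPreFamily) :=
  ⨆ n, (psiSkelTop ψ X n).coinduced Subtype.val

/-- `ψX` over the base of `X`, with fibre `ψ(X_b)` over `b`. -/
noncomputable def psiFamily : PreFamily 𝒲 where
  Total := PsiTotal ψ X.toPreFamily
  Base := X.Base
  topTotal := psiTop ψ X
  topBase := X.topBase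
  proj x := x.1
  fiber b := ψ.obj (X.fiber b)
  chart b := Equiv.sigmaSubtype b

/-- The characteristic maps of `ψX`. -/
noncomputable def psiChar (n : ℕ) :
    PreMap (VFamily.cells (fun c => ψ.obj (X.cells.cellFiber n c)) (Disk n)).toPreFamily
      (psiFamily ψ X) where
  toFun := psiCharFun ψ X n
  base := (X.cells.char n).base
  comm _ := rfl
  fiber_mem b := ⟨ψ.map ((X.cells.char n).fiberMap b), by rintro ⟨⟨c, e, v⟩, rfl⟩; rfl⟩

/-- The cell decomposition of `ψX`: the same skeleta and cells as `X`, and the `𝒲`-sets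
`ψ(Z_n)`. -/
noncomputable def psiCells : PreCells (psiFamily ψ X) where
  skel := X.cells.skel
  Cell := X.cells.Cell
  cellFiber n c := ψ.obj (X.cells.cellFiber n c)
  char := psiChar ψ X

variable {X} in
/-- `ψ(f)` for a map `f : X → Y`: over `b` it is `ψ` of the morphism `X_b → Y_{f b}`. -/
noncomputable def psiMap {Y : VComplex 𝒱} (f : X ⟶ Y) :
    PreMap (psiFamily ψ X) (psiFamily ψ Y) where
  toFun := psiFun ψ (VMap.toPreMap f)
  base := (VMap.toPreMap f).base
  comm _ := rfl
  fiber_mem b := ⟨ψ.map ((VMap.toPreMap f).fiberMap b), by rintro ⟨⟨b, v⟩, rfl⟩; rfl⟩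

/-- `ψX` as a `𝒲`-complex, once it is known to be one. -/
noncomputable def psiComplex (h : (psiCells ψ X).IsComplex) : VComplex 𝒲 :=
  ⟨psiFamily ψ X, psiCells ψ X, h⟩

variable {X} in
/-- `ψ(f)` as a `𝒲`-map, once it is known to be continuous. -/
noncomputable def psiHom {Y : VComplex 𝒱} (f : X ⟶ Y) (hX : (psiCells ψ X).IsComplex)
    (hY : (psiCells ψ Y).IsComplex) (hf : (psiMap ψ f).IsContinuous) :
    psiComplex ψ X hX ⟶ psiComplex ψ Y hY :=
  VMap.mk (X := (psiComplex ψ X hX).toVFamily) (Y := (psiComplex ψ Y hY).toVFamily)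
    (psiMap ψ f) hf

/-- The map `X^V → (ψX)^{ψV}` that sends `a : V → X_b ⊆ X` to
`ψ(a) : ψ(V) → ψ(X_b) ⊆ ψX`. -/
noncomputable def psiHat (h : (psiFamily ψ X).IsFamily) (V : 𝒱.Obj)
    (a : FunSpace V X.toVFamily) : FunSpace (ψ.obj V) (⟨psiFamily ψ X, h⟩ : VFamily 𝒲) :=
  VMap.mk (X := VFamily.point (ψ.obj V)) (Y := ⟨psiFamily ψ X, h⟩)
    { toFun := fun w => psiFun ψ (VMap.toPreMap a) ⟨PUnit.unit, w⟩
      base := fun _ => (VMap.toPreMap a).base PUnit.unit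
      comm := fun _ => rfl
      fiber_mem := fun b => ⟨ψ.map ((VMap.toPreMap a).fiberMap PUnit.unit), fun _ => rfl⟩ }
    { continuous_toFun := by
        have hc := (((psiFamily ψ X).chart
          ((VMap.toPreMap a).base PUnit.unit)).toHomeomorphOfIsInducing
          (h.isHomeomorph_chart _).isInducing).symm.continuous
        have hl : Continuous (lin (ψ.map ((VMap.toPreMap a).fiberMap PUnit.unit))) :=
          IsModuleTopology.continuous_of_linearMap _
        exact continuous_subtype_val.comp (hc.comp hl)
      continuous_base := continuous_const }

end Psi

/-! Everything rests on one continuity statement, `isOpen_psi_preimage`. Let maps `a t : V ⟶ X_{β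
t}` depend on a parameter `t` in such a way that `t ↦ a t v` is continuous into `X` for every vector
`v`. Then `(t, w) ↦ ψ(a t) w` is continuous into `ψX`. With a sphere as parameter space this gives
the attaching maps of `ψX`, with a disk it gives `ψ(f)` on a cell, and with `X^V` it gives the map
`ψ^V`. The target set only has to be open on cells below a skeleton that contains `β t`, so the
statement already applies to the attaching maps, before `ψX` is known to be a complex.

To prove it, fix a target set `O`, and a compact neighbourhood `B` of `w₀` with `ψ(a t₀)(B) ⊆ O`.
The maps `g` with `ψ(g)(B) ⊆ O` form a set `Q` that is open when read in the cells. For a finite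
spanning family `v i` of `V` one needs open sets `U i` of `X` with `a t₀ (v i) ∈ U i` such that
every map sending each `v i` into `U i` lies in `Q` (`exists_isOpen_of_isOpenOnCells`). They are
built skeleton by skeleton. Over an `n`-cell the traces on the boundary are prescribed, and a
careless open extension admits maps outside `Q`. The shrinking lemma `exists_isOpen_shrink` repairs
this: on each stage of a compact exhaustion the bad maps keep a positive distance from the boundary,
and the stage is cut off at that distance.

The shrinking needs that the maps sending a spanning family into a compact set form a compact set.
This holds for closed hom-sets, so the argument runs in the closure of `𝒱`, with `ψ` extended
continuously to it (`ClosureExtension`).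

The cell structure enters through `IsGlued`, a concrete description by points and topology that is
equivalent to the categorical push-out (`isGlued_of_isPushout`, `IsGlued.isPushout`). It makes
openness testable on cells. Once the attaching maps of `ψX` are continuous, its skeleta are closed
subspaces, and the charts and push-outs of `ψX` follow. -/

/-! ## Points of families and maps of families -/

namespace PreFamily

/-- The point of the total space over `b` with coordinate `v`. -/
def pt (X : PreFamily 𝒱) (b : X.Base) (v : X.fiber b) : X.Total := ((X.chart b).symm v).1

variable {X : PreFamily 𝒱}

@[simp] theorem proj_pt (b : X.Base) (v : X.fiber b) : X.proj (X.pt b v) = b :=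
  ((X.chart b).symm v).2

theorem chart_pt (b : X.Base) (v : X.fiber b) (h : X.proj (X.pt b v) = b) :
    X.chart b ⟨X.pt b v, h⟩ = v :=
  (X.chart b).apply_symm_apply v

theorem pt_chart (b : X.Base) (x : {x : X.Total // X.proj x = b}) :
    X.pt b (X.chart b x) = x.1 :=
  congrArg Subtype.val ((X.chart b).symm_apply_apply x)

theorem pt_injective (b : X.Base) : Function.Injective (X.pt b) :=
  Subtype.val_injective.comp (X.chart b).symm.injective

theorem exists_pt_of_proj (x : X.Total) {b : X.Base} (h : X.proj x = b) : ∃ v, x = X.pt b v :=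
  ⟨X.chart b ⟨x, h⟩, (X.pt_chart b ⟨x, h⟩).symm⟩

theorem exists_pt (x : X.Total) : ∃ b v, x = X.pt b v := ⟨_, exists_pt_of_proj x rfl⟩

theorem base_eq_of_pt_eq {b b' : X.Base} {v : X.fiber b} {v' : X.fiber b'}
    (h : X.pt b v = X.pt b' v') : b = b' := by
  rw [← X.proj_pt b v, h, X.proj_pt]

theorem IsFamily.continuous_pt (hX : X.IsFamily) (b : X.Base) : Continuous (X.pt b) :=
  continuous_subtype_val.comp
    ((X.chart b).toHomeomorphOfIsInducing (hX.isHomeomorph_chart b).isInducing).symm.continuous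

theorem isFamily_iff : X.IsFamily ↔
    Continuous X.proj ∧ ∀ b, Continuous (X.chart b) ∧ Continuous (X.pt b) := by
  constructor
  · exact fun h => ⟨h.1, fun b => ⟨(h.2 b).continuous, h.continuous_pt b⟩⟩
  · exact fun h => ⟨h.1, fun b => Homeomorph.isHomeomorph
      ⟨X.chart b, (h.2 b).1, continuous_induced_rng.2 (h.2 b).2⟩⟩

end PreFamily

namespace PreMap

variable {X Y Z : PreFamily 𝒱}

theorem toFun_pt (f : PreMap X Y) (b : X.Base) (v : X.fiber b) :
    f.toFun (X.pt b v) = Y.pt (f.base b) (lin (f.fiberMap b) v) := by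
  have h := f.chart_toFun b ((X.chart b).symm v)
  rw [Equiv.apply_symm_apply] at h
  rw [← h, Y.pt_chart]
  rfl

/-- `fiberMap` is a choice, but `pt` is injective on fibres, so at most one morphism fits. All fibre
morphisms below are computed this way. -/
theorem fiberMap_eq (f : PreMap X Y) {b : X.Base} {m : X.fiber b ⟶ Y.fiber (f.base b)}
    (h : ∀ v, f.toFun (X.pt b v) = Y.pt (f.base b) (lin m v)) : f.fiberMap b = m := by
  refine lin_injective (LinearMap.ext fun v => Y.pt_injective _ ?_)
  rw [← h, f.toFun_pt]

@[simp] theorem id_fiberMap (b : X.Base) : (PreMap.id X).fiberMap b = 𝟙 _ :=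
  fiberMap_eq _ fun _ => rfl

theorem comp_fiberMap (f : PreMap X Y) (g : PreMap Y Z) (b : X.Base) :
    (f.comp g).fiberMap b = f.fiberMap b ≫ g.fiberMap (f.base b) := by
  refine fiberMap_eq _ fun v => ?_
  change g.toFun (f.toFun _) = _
  rw [toFun_pt, toFun_pt]
  rfl

/-- A map of families given by its base map and its fibre morphisms. -/
def ofFiber (base : X.Base → Y.Base) (m : ∀ b, X.fiber b ⟶ Y.fiber (base b)) : PreMap X Y where
  toFun x := Y.pt (base (X.proj x)) (lin (m _) (X.chart _ ⟨x, rfl⟩))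
  base := base
  comm x := Y.proj_pt _ _
  fiber_mem b := ⟨m b, by rintro ⟨x, rfl⟩; exact Y.chart_pt _ _ _⟩

theorem ofFiber_fiberMap (base : X.Base → Y.Base) (m : ∀ b, X.fiber b ⟶ Y.fiber (base b))
    (b : X.Base) : (ofFiber base m).fiberMap b = m b := by
  refine lin_injective (LinearMap.ext fun v => ?_)
  obtain ⟨x, rfl⟩ := (X.chart b).surjective v
  rw [← chart_toFun]
  obtain ⟨x, rfl⟩ := x
  exact Y.chart_pt _ _ _

theorem ofFiber_pt (base : X.Base → Y.Base) (m : ∀ b, X.fiber b ⟶ Y.fiber (base b))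
    (b : X.Base) (v : X.fiber b) :
    (ofFiber base m).toFun (X.pt b v) = Y.pt (base b) (lin (m b) v) := by
  rw [toFun_pt, ofFiber_fiberMap]
  rfl

/-- For a composite `f.comp g` equal to the identity, the target fibre lies over `g (f b)`, which is
only propositionally `b`. Substituting the whole map avoids a transport. -/
theorem isIso_fiberMap_of_eq_id {h : PreMap X X} (e : h = PreMap.id X) (b : X.Base) :
    IsIso (h.fiberMap b) := by
  subst e
  rw [id_fiberMap]
  exact inferInstanceAs (IsIso (𝟙 (X.fiber b)))

/-- Two-out-of-six: the first composite makes `y` a split epimorphism, the second makes it a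
monomorphism. -/
theorem isIso_of_comp_of_comp {𝒞 : Type*} [Category 𝒞] {U V W T : 𝒞} (x : U ⟶ V) (y : V ⟶ W)
    (z : W ⟶ T) [IsIso (x ≫ y)] [IsIso (y ≫ z)] : IsIso x := by
  have : IsSplitEpi y := ⟨⟨inv (x ≫ y) ≫ x, by simp⟩⟩
  have : Mono y := mono_of_mono y z
  have : IsIso y := isIso_of_mono_of_isSplitEpi y
  exact IsIso.of_isIso_comp_right x y

/-- The fibre morphisms of an invertible map are isomorphisms. -/
theorem isIso_fiberMap {f : PreMap X Y} {g : PreMap Y X} (h₁ : f.comp g = PreMap.id X)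
    (h₂ : g.comp f = PreMap.id Y) (b : X.Base) : IsIso (f.fiberMap b) := by
  have i₁ := isIso_fiberMap_of_eq_id h₁ b
  have i₂ := isIso_fiberMap_of_eq_id h₂ (f.base b)
  rw [comp_fiberMap] at i₁ i₂
  exact @isIso_of_comp_of_comp _ _ _ _ _ _ (f.fiberMap b) (g.fiberMap (f.base b))
    (f.fiberMap (g.base (f.base b))) i₁ i₂

theorem exists_toFun_eq (f : PreMap X Y) (b : X.Base) [IsIso (f.fiberMap b)]
    (v : Y.fiber (f.base b)) :
    f.toFun (X.pt b (lin (inv (f.fiberMap b)) v)) = Y.pt (f.base b) v := by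
  rw [toFun_pt]
  congr 1
  change lin (inv (f.fiberMap b) ≫ f.fiberMap b) v = v
  rw [IsIso.inv_hom_id]
  rfl

theorem lin_inv_apply {V W : 𝒱.Obj} (m : V ⟶ W) [IsIso m] (v : V) : lin (inv m) (lin m v) = v := by
  change lin (m ≫ inv m) v = v
  rw [IsIso.hom_inv_id]
  rfl

theorem lin_apply_inv {V W : 𝒱.Obj} (m : V ⟶ W) [IsIso m] (v : W) : lin m (lin (inv m) v) = v := by
  change lin (inv m ≫ m) v = v
  rw [IsIso.inv_hom_id]
  rfl

theorem injective_toFun (f : PreMap X Y) (hf : Function.Injective f.base)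
    (hi : ∀ b, IsIso (f.fiberMap b)) : Function.Injective f.toFun := by
  intro x y hxy
  obtain ⟨b, v, rfl⟩ := X.exists_pt x
  obtain ⟨b', v', rfl⟩ := X.exists_pt y
  rw [toFun_pt, toFun_pt] at hxy
  obtain rfl := hf (Y.base_eq_of_pt_eq hxy)
  have := hi b
  rw [← lin_inv_apply (f.fiberMap b) v, Y.pt_injective _ hxy, lin_inv_apply]

theorem ext_toFun {f g : PreMap X Y} (h : ∀ x, f.toFun x = g.toFun x) : f = g := by
  refine PreMap.ext (funext h) (funext fun b => ?_)
  rw [← X.proj_pt b 0, ← f.comm, h, g.comm]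

/-- A chart over `f b` is a homeomorphism if `f` embeds the fibre over `b` isomorphically. -/
theorem chart_of_isEmbedding (f : PreMap X Y) (hX : X.IsFamily) (b : X.Base)
    [IsIso (f.fiberMap b)]
    (hf : IsEmbedding fun x : {x : X.Total // X.proj x = b} => f.toFun x.1) :
    Continuous (Y.chart (f.base b)) ∧ Continuous (Y.pt (f.base b)) := by
  have hb := (X.chart b).toHomeomorphOfIsInducing (hX.isHomeomorph_chart b).isInducing
  let L : X.fiber b ≃ₜ Y.fiber (f.base b) :=
    { toFun := lin (f.fiberMap b)
      invFun := lin (inv (f.fiberMap b))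
      left_inv := lin_inv_apply _
      right_inv := lin_apply_inv _
      continuous_toFun := IsModuleTopology.continuous_of_linearMap _
      continuous_invFun := IsModuleTopology.continuous_of_linearMap _ }
  let F : X.fiber b ≃ₜ {x : X.Total // X.proj x = b} :=
    ((X.chart b).toHomeomorphOfIsInducing (hX.isHomeomorph_chart b).isInducing).symm
  -- The parametrization of the fibre over `f b` is the inverse fibre isomorphism, followed by the
  -- inverse chart of `X` and by `f`. It is an embedding because `f` is one on this fibre.
  have hpt : Y.pt (f.base b) = (fun x : {x : X.Total // X.proj x = b} => f.toFun x.1) ∘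
      F ∘ L.symm := by
    funext v
    exact (f.exists_toFun_eq b v).symm
  have he : IsEmbedding (Y.pt (f.base b)) := by
    rw [hpt]
    exact hf.comp (F.isEmbedding.comp L.symm.isEmbedding)
  refine ⟨?_, he.continuous⟩
  rw [he.continuous_iff]
  exact continuous_subtype_val.congr fun x => (Y.pt_chart _ x).symm

end PreMap

theorem VMap.ext_toPreMap {X Y : VFamily 𝒱} {f g : VMap X Y} (h : f.toPreMap = g.toPreMap) :
    f = g :=
  VMap.ext (congrArg PreMap.toFun h) (congrArg PreMap.base h)

open VFamily

/-! ## Gluing along a closed embedding -/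

section Glue

variable {A Z S P : Type*} [TopologicalSpace A] [TopologicalSpace Z] [TopologicalSpace S]
  [tP : TopologicalSpace P] {i : S → Z} {h : S → A} {j : A → P} {φ : Z → P}

theorem isOpen_iff_of_glue
    (ht : tP = TopologicalSpace.coinduced j inferInstance ⊔
      TopologicalSpace.coinduced φ inferInstance)
    {U : Set P} : IsOpen U ↔ IsOpen (j ⁻¹' U) ∧ IsOpen (φ ⁻¹' U) := by
  subst ht
  rfl

theorem isClosed_iff_of_glue
    (ht : tP = TopologicalSpace.coinduced j inferInstance ⊔
      TopologicalSpace.coinduced φ inferInstance)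
    {F : Set P} : IsClosed F ↔ IsClosed (j ⁻¹' F) ∧ IsClosed (φ ⁻¹' F) := by
  simp only [← isOpen_compl_iff, isOpen_iff_of_glue ht, Set.preimage_compl]

theorem continuous_left_of_glue
    (ht : tP = TopologicalSpace.coinduced j inferInstance ⊔
      TopologicalSpace.coinduced φ inferInstance) :
    Continuous j :=
  ⟨fun _ hU => ((isOpen_iff_of_glue ht).1 hU).1⟩

theorem continuous_right_of_glue
    (ht : tP = TopologicalSpace.coinduced j inferInstance ⊔
      TopologicalSpace.coinduced φ inferInstance) :
    Continuous φ :=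
  ⟨fun _ hU => ((isOpen_iff_of_glue ht).1 hU).2⟩

theorem continuous_of_glue
    (ht : tP = TopologicalSpace.coinduced j inferInstance ⊔
      TopologicalSpace.coinduced φ inferInstance)
    {Y : Type*} [TopologicalSpace Y] {u : P → Y} (h₁ : Continuous (u ∘ j))
    (h₂ : Continuous (u ∘ φ)) : Continuous u :=
  ⟨fun _ hU => (isOpen_iff_of_glue ht).2 ⟨hU.preimage h₁, hU.preimage h₂⟩⟩

/-- Attaching along a closed embedding: the old space is a closed subspace of the new one. -/
theorem isClosedEmbedding_of_glue (hi : IsClosedEmbedding i) (hh : Continuous h)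
    (hj : Function.Injective j) (comm : ∀ s, j (h s) = φ (i s))
    (hpre : ∀ z a, φ z = j a → z ∈ Set.range i)
    (ht : tP = TopologicalSpace.coinduced j inferInstance ⊔
      TopologicalSpace.coinduced φ inferInstance) :
    IsClosedEmbedding j := by
  refine IsClosedEmbedding.of_continuous_injective_isClosedMap (continuous_left_of_glue ht) hj
    fun F hF => (isClosed_iff_of_glue ht).2 ⟨by rwa [Set.preimage_image_eq _ hj], ?_⟩
  -- Only boundary points of `Z` meet the image of `A`, so closedness in `Z` is inherited from `A`
  -- through the closed map `i`.
  have : φ ⁻¹' (j '' F) = i '' (h ⁻¹' F) := by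
    ext z
    constructor
    · rintro ⟨a, ha, haz⟩
      obtain ⟨s, rfl⟩ := hpre z a haz.symm
      refine ⟨s, ?_, rfl⟩
      rw [← comm] at haz
      obtain rfl := hj haz
      exact ha
    · rintro ⟨s, hs, rfl⟩
      exact ⟨h s, hs, comm s⟩
  rw [this]
  exact hi.isClosedMap _ (hF.preimage hh)

/-- Attaching along a closed embedding: the complement of the boundary is an open subspace. -/
theorem isOpenEmbedding_of_glue (hi : IsClosedEmbedding i) (comm : ∀ s, j (h s) = φ (i s))
    (hpre : ∀ z a, φ z = j a → z ∈ Set.range i)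
    (hφ : ∀ z z', z ∉ Set.range i → z' ∉ Set.range i → φ z = φ z' → z = z')
    (ht : tP = TopologicalSpace.coinduced j inferInstance ⊔
      TopologicalSpace.coinduced φ inferInstance) :
    IsOpenEmbedding fun z : {z // z ∉ Set.range i} => φ z.1 := by
  refine IsOpenEmbedding.of_continuous_injective_isOpenMap
    ((continuous_right_of_glue ht).comp continuous_subtype_val)
    (fun z z' hz => Subtype.ext (hφ _ _ z.2 z'.2 hz)) fun U hU => (isOpen_iff_of_glue ht).2 ?_
  constructor
  · convert isOpen_empty
    ext a
    refine ⟨?_, False.elim⟩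
    rintro ⟨z, -, hz⟩
    exact z.2 (hpre _ _ hz)
  · convert hi.isClosed_range.isOpen_compl.isOpenMap_subtype_val U hU using 1
    ext z
    constructor
    · rintro ⟨z', hz', h'⟩
      by_cases hz : z ∈ Set.range i
      · obtain ⟨s, rfl⟩ := hz
        exact absurd (hpre z'.1 (h s) (h'.trans (comm s).symm)) z'.2
      · exact ⟨z', hz', hφ _ _ z'.2 hz h'⟩
    · rintro ⟨z', hz', rfl⟩
      exact ⟨z', hz', rfl⟩

theorem topology_eq_of_glue_comp
    (ht : tP = TopologicalSpace.coinduced j inferInstance ⊔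
      TopologicalSpace.coinduced φ inferInstance)
    {Q : Type*} [tQ : TopologicalSpace Q] (f : P ≃ₜ Q) :
    tQ = TopologicalSpace.coinduced (f ∘ j) inferInstance ⊔
      TopologicalSpace.coinduced (f ∘ φ) inferInstance := by
  exact f.coinduced_eq.symm.trans ((congrArg (TopologicalSpace.coinduced f) ht).trans
    (by rw [coinduced_sup, coinduced_compose, coinduced_compose]))

end Glue

theorem isClosedEmbedding_bdIncl (n : ℕ) : IsClosedEmbedding (bdIncl n) :=
  (bdIncl n).continuous.isClosedEmbedding
    (Set.inclusion_injective Metric.sphere_subset_closedBall)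

theorem mem_range_cellsMap_toFun {C : Type u} {V : C → 𝒱.Obj} {n : ℕ}
    {z : (cells V (Disk n)).Total} :
    z ∈ Set.range (cellsMap V (bdIncl n)).toFun ↔ z.2.1 ∈ Set.range (bdIncl n) := by
  constructor
  · rintro ⟨s, rfl⟩
    exact ⟨s.2.1, rfl⟩
  · obtain ⟨c, e, v⟩ := z
    rintro ⟨s, rfl⟩
    exact ⟨⟨c, s, v⟩, rfl⟩

theorem isClosedEmbedding_cellsMap_toFun {C : Type u} (V : C → 𝒱.Obj) (n : ℕ) :
    IsClosedEmbedding (cellsMap V (bdIncl n)).toFun where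
  toIsEmbedding := (isEmbedding_sigmaMap (σ := fun c => BdSphere n × V c)
    (τ := fun c => Disk n × V c) (f₁ := _root_.id) (f₂ := fun _ => Prod.map (bdIncl n) _root_.id)
    Function.injective_id).2 fun _ => (isClosedEmbedding_bdIncl n).isEmbedding.prodMap .id
  isClosed_range := by
    refine isClosed_sigma_iff.2 fun c => ?_
    convert (isClosedEmbedding_bdIncl n).isClosed_range.preimage
      (continuous_fst : Continuous (Prod.fst : Disk n × V c → _)) using 1
    ext z
    exact mem_range_cellsMap_toFun

/-! ### Attaching cells: the concrete form of the push-out -/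

/-- `P` is obtained from `B` by attaching cells: as a set it is the disjoint union of `B` and the
interiors of the cells, and its topology is the finest one for which the maps from `B` and from
the cells are continuous. -/
structure IsGlued {B P : PreFamily 𝒱} {C : Type u} {V : C → 𝒱.Obj} {n : ℕ} (j : PreMap B P)
    (Φ : PreMap (cells V (Disk n)).toPreFamily P) : Prop where
  base_injective : Function.Injective j.base
  isIso_fiberMap : ∀ b, IsIso (j.fiberMap b)
  char_injective : ∀ p q : (cells V (Disk n)).Base, p.2 ∉ Set.range (bdIncl n) →
    q.2 ∉ Set.range (bdIncl n) → Φ.base p = Φ.base q → p = q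
  isIso_char : ∀ p : (cells V (Disk n)).Base, p.2 ∉ Set.range (bdIncl n) → IsIso (Φ.fiberMap p)
  char_mem_range : ∀ (p : (cells V (Disk n)).Base) b, Φ.base p = j.base b →
    p.2 ∈ Set.range (bdIncl n)
  cover : ∀ b, (∃ b₀, j.base b₀ = b) ∨
    ∃ p : (cells V (Disk n)).Base, p.2 ∉ Set.range (bdIncl n) ∧ Φ.base p = b
  topTotal_eq : P.topTotal = TopologicalSpace.coinduced j.toFun inferInstance ⊔
    TopologicalSpace.coinduced Φ.toFun inferInstance
  topBase_eq : P.topBase = TopologicalSpace.coinduced j.base inferInstance ⊔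
    TopologicalSpace.coinduced Φ.base inferInstance

namespace IsGlued

variable {B P : PreFamily 𝒱} {C : Type u} {V : C → 𝒱.Obj} {n : ℕ} {j : PreMap B P}
    {Φ : PreMap (cells V (Disk n)).toPreFamily P}
    {h : PreMap (cells V (BdSphere n)).toPreFamily B}

theorem continuous_left (g : IsGlued j Φ) : j.IsContinuous :=
  ⟨continuous_left_of_glue g.topTotal_eq, continuous_left_of_glue g.topBase_eq⟩

theorem continuous_right (g : IsGlued j Φ) : Φ.IsContinuous :=
  ⟨continuous_right_of_glue g.topTotal_eq, continuous_right_of_glue g.topBase_eq⟩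

theorem toFun_injective (g : IsGlued j Φ) : Function.Injective j.toFun :=
  j.injective_toFun g.base_injective g.isIso_fiberMap

theorem char_toFun_mem_range (g : IsGlued j Φ) (z : (cells V (Disk n)).Total) (a : B.Total)
    (e : Φ.toFun z = j.toFun a) : z ∈ Set.range (cellsMap V (bdIncl n)).toFun := by
  refine mem_range_cellsMap_toFun.2 (g.char_mem_range ((cells V (Disk n)).proj z) (B.proj a) ?_)
  rw [← Φ.comm, e, j.comm]

theorem char_toFun_injective (g : IsGlued j Φ) (z z' : (cells V (Disk n)).Total)
    (hz : z ∉ Set.range (cellsMap V (bdIncl n)).toFun)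
    (hz' : z' ∉ Set.range (cellsMap V (bdIncl n)).toFun) (e : Φ.toFun z = Φ.toFun z') : z = z' := by
  rw [mem_range_cellsMap_toFun] at hz hz'
  obtain ⟨b, v, rfl⟩ := (cells V (Disk n)).exists_pt z
  obtain ⟨b', v', rfl⟩ := (cells V (Disk n)).exists_pt z'
  rw [Φ.toFun_pt, Φ.toFun_pt] at e
  obtain rfl := g.char_injective b b' hz hz' (P.base_eq_of_pt_eq e)
  have := g.isIso_char b hz
  rw [← PreMap.lin_inv_apply (Φ.fiberMap b) v, P.pt_injective _ e, PreMap.lin_inv_apply]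

theorem isClosedEmbedding_toFun (g : IsGlued j Φ) (hh : h.IsContinuous)
    (comm : h.comp j = (cellsMap V (bdIncl n)).toPreMap.comp Φ) : IsClosedEmbedding j.toFun :=
  isClosedEmbedding_of_glue (isClosedEmbedding_cellsMap_toFun V n) hh.1 g.toFun_injective
    (congrFun (congrArg PreMap.toFun comm)) g.char_toFun_mem_range g.topTotal_eq

/-- A family to which cells are attached remains a family. -/
theorem isFamily (g : IsGlued j Φ) (hB : B.IsFamily) (hh : h.IsContinuous)
    (comm : h.comp j = (cellsMap V (bdIncl n)).toPreMap.comp Φ) : P.IsFamily := by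
  refine PreFamily.isFamily_iff.2 ⟨continuous_of_glue g.topTotal_eq ?_ ?_, fun b => ?_⟩
  · rw [show P.proj ∘ j.toFun = _ from funext j.comm]
    exact g.continuous_left.2.comp hB.1
  · rw [show P.proj ∘ Φ.toFun = _ from funext Φ.comm]
    exact g.continuous_right.2.comp (cells V (Disk n)).isFamily.1
  -- An old fibre is embedded by the closed embedding `j`; a new one by the characteristic map,
  -- which is an open embedding on the interiors of cells.
  · rcases g.cover b with ⟨b, rfl⟩ | ⟨p, hp, rfl⟩
    · have := g.isIso_fiberMap b
      exact j.chart_of_isEmbedding hB b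
        ((g.isClosedEmbedding_toFun hh comm).isEmbedding.comp .subtypeVal)
    · have := g.isIso_char p hp
      refine Φ.chart_of_isEmbedding (cells V (Disk n)).isFamily p ?_
      have := isOpenEmbedding_of_glue (h := h.toFun) (j := j.toFun) (φ := Φ.toFun)
        (isClosedEmbedding_cellsMap_toFun V n)
        (congrFun (congrArg PreMap.toFun comm)) g.char_toFun_mem_range g.char_toFun_injective
        g.topTotal_eq
      have hmem : ∀ x : {x : (cells V (Disk n)).Total // (cells V (Disk n)).proj x = p},
          x.1 ∉ Set.range (cellsMap V (bdIncl n)).toFun := by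
        rintro ⟨x, rfl⟩
        rwa [mem_range_cellsMap_toFun]
      exact this.isEmbedding.comp (f := fun x => ⟨x.1, hmem x⟩)
        (IsEmbedding.of_comp (g := Subtype.val) (continuous_induced_rng.2
          continuous_subtype_val) continuous_subtype_val .subtypeVal)

/-- The maps from `B` and from the cells extend to `P`. -/
theorem exists_desc (g : IsGlued j Φ)
    (comm : h.comp j = (cellsMap V (bdIncl n)).toPreMap.comp Φ) {W : PreFamily 𝒱}
    (β : PreMap B W) (γ : PreMap (cells V (Disk n)).toPreFamily W)
    (comm' : h.comp β = (cellsMap V (bdIncl n)).toPreMap.comp γ) :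
    ∃ u : PreMap P W, j.comp u = β ∧ Φ.comp u = γ := by
  -- A single base point and fibre morphism must serve both maps into `W`; the two clauses record
  -- agreement with `β` and with `γ`.
  have key : ∀ b, ∃ (w : W.Base) (m : P.fiber b ⟶ W.fiber w), ∀ v,
      (∀ x, j.toFun x = P.pt b v → β.toFun x = W.pt w (lin m v)) ∧
      (∀ z, Φ.toFun z = P.pt b v → γ.toFun z = W.pt w (lin m v)) := by
    intro b
    rcases g.cover b with ⟨b, rfl⟩ | ⟨p, hp, rfl⟩
    · have := g.isIso_fiberMap b
      refine ⟨β.base b, inv (j.fiberMap b) ≫ β.fiberMap b, fun v => ?_⟩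
      have h₁ : ∀ x, j.toFun x = P.pt (j.base b) v →
          β.toFun x = W.pt (β.base b) (lin (inv (j.fiberMap b) ≫ β.fiberMap b) v) := by
        intro x hx
        rw [← j.exists_toFun_eq b v] at hx
        rw [g.toFun_injective hx, β.toFun_pt]
        rfl
      refine ⟨h₁, fun z hz => ?_⟩
      -- A cell point over an old base point lies on the boundary, where the two commuting squares
      -- reduce the claim to `h₁`.
      obtain ⟨s, rfl⟩ := g.char_toFun_mem_range z _ (hz.trans (j.exists_toFun_eq b v).symm)
      exact (congrFun (congrArg PreMap.toFun comm') s).symm.trans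
        (h₁ _ ((congrFun (congrArg PreMap.toFun comm) s).trans hz))
    · have := g.isIso_char p hp
      refine ⟨γ.base p, inv (Φ.fiberMap p) ≫ γ.fiberMap p, fun v => ⟨fun x hx => ?_, fun z hz => ?_⟩⟩
      · refine absurd (g.char_mem_range p (B.proj x) ?_) hp
        rw [← j.comm, hx, P.proj_pt]
      · have hz' : z ∉ Set.range (cellsMap V (bdIncl n)).toFun := by
          rintro ⟨s, rfl⟩
          refine hp (g.char_mem_range p (B.proj (h.toFun s)) ?_)
          rw [← j.comm]
          rw [← P.proj_pt (Φ.base p) v, ← hz]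
          exact congrArg P.proj (congrFun (congrArg PreMap.toFun comm) s).symm
        rw [← Φ.exists_toFun_eq p v] at hz
        rw [g.char_toFun_injective _ _ hz' (fun hr => hp (mem_range_cellsMap_toFun.1 hr)) hz,
          γ.toFun_pt]
        rfl
  choose w m hm using key
  refine ⟨PreMap.ofFiber w m, PreMap.ext_toFun fun x => ?_, PreMap.ext_toFun fun z => ?_⟩
  · obtain ⟨b, v, hx⟩ := P.exists_pt (j.toFun x)
    change (PreMap.ofFiber w m).toFun (j.toFun x) = _
    rw [hx, PreMap.ofFiber_pt, (hm b v).1 x hx]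
  · obtain ⟨b, v, hx⟩ := P.exists_pt (Φ.toFun z)
    change (PreMap.ofFiber w m).toFun (Φ.toFun z) = _
    rw [hx, PreMap.ofFiber_pt, (hm b v).2 z hx]

theorem hom_ext (g : IsGlued j Φ) {W : PreFamily 𝒱} {u u' : PreMap P W}
    (h₁ : j.comp u = j.comp u') (h₂ : Φ.comp u = Φ.comp u') : u = u' := by
  refine PreMap.ext_toFun fun x => ?_
  obtain ⟨b, v, rfl⟩ := P.exists_pt x
  rcases g.cover b with ⟨b, rfl⟩ | ⟨p, hp, rfl⟩
  · have := g.isIso_fiberMap b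
    rw [← j.exists_toFun_eq b v]
    exact congrFun (congrArg PreMap.toFun h₁) _
  · have := g.isIso_char p hp
    rw [← Φ.exists_toFun_eq p v]
    exact congrFun (congrArg PreMap.toFun h₂) _

end IsGlued

/-- Attaching cells is a push-out in the category of families. -/
theorem IsGlued.isPushout {B P : VFamily 𝒱} {C : Type u} {V : C → 𝒱.Obj} {n : ℕ} {j : B ⟶ P}
    {Φ : cells V (Disk n) ⟶ P} {h : cells V (BdSphere n) ⟶ B}
    (g : IsGlued (VMap.toPreMap j) (VMap.toPreMap Φ)) (comm : h ≫ j = cellsMap V (bdIncl n) ≫ Φ) :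
    IsPushout h (cellsMap V (bdIncl n)) j Φ := by
  refine ⟨⟨comm⟩, ⟨Limits.PushoutCocone.isColimitAux' _ fun s => ?_⟩⟩
  have hs : h ≫ s.inl = cellsMap V (bdIncl n) ≫ s.inr := s.condition
  have hd := g.exists_desc (congrArg VMap.toPreMap comm) (VMap.toPreMap s.inl)
    (VMap.toPreMap s.inr) (congrArg VMap.toPreMap hs)
  refine ⟨VMap.mk hd.choose ⟨continuous_of_glue g.topTotal_eq ?_ ?_,
    continuous_of_glue g.topBase_eq ?_ ?_⟩, VMap.ext_toPreMap hd.choose_spec.1,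
    VMap.ext_toPreMap hd.choose_spec.2, fun {m} h₁ h₂ => VMap.ext_toPreMap (g.hom_ext ?_ ?_)⟩
  · exact (VMap.isContinuous s.inl).1.congr
      fun x => (congrFun (congrArg PreMap.toFun hd.choose_spec.1) x).symm
  · exact (VMap.isContinuous s.inr).1.congr
      fun x => (congrFun (congrArg PreMap.toFun hd.choose_spec.2) x).symm
  · exact (VMap.isContinuous s.inl).2.congr
      fun x => (congrFun (congrArg PreMap.base hd.choose_spec.1) x).symm
  · exact (VMap.isContinuous s.inr).2.congr
      fun x => (congrFun (congrArg PreMap.base hd.choose_spec.2) x).symm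
  · exact (congrArg VMap.toPreMap h₁).trans hd.choose_spec.1.symm
  · exact (congrArg VMap.toPreMap h₂).trans hd.choose_spec.2.symm

/-! ## The push-out as a set -/

section Attach

variable (B : PreFamily 𝒱) {C : Type u} (V : C → 𝒱.Obj) {n : ℕ}
  (h : PreMap (cells V (BdSphere n)).toPreFamily B)

/-- The base of the space obtained by attaching cells to `B`. -/
abbrev AttachBase (B : PreFamily 𝒱) (C : Type u) (n : ℕ) : Type u :=
  B.Base ⊕ Σ _ : C, {e : Disk n // e ∉ Set.range (bdIncl n)}

/-- The fibres of the space obtained by attaching cells to `B`. -/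
abbrev attachFiber (b : AttachBase B C n) : 𝒱.Obj := Sum.elim B.fiber (fun p => V p.1) b

/-- The space obtained by attaching cells to `B`, as a set. -/
def attachSet : PreFamily 𝒱 where
  Total := Σ b : AttachBase B C n, attachFiber B V b
  Base := AttachBase B C n
  topTotal := ⊤
  topBase := ⊤
  proj x := x.1
  fiber := attachFiber B V
  chart b := Equiv.sigmaSubtype b

variable {V}

open Classical in
/-- The image of a point of a cell in the attached space, with the morphism of the fibres. -/
noncomputable def attachCell (p : (cells V (Disk n)).Base) :
    Σ b : AttachBase B C n, (V p.1 ⟶ attachFiber B V b) :=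
  if hp : p.2 ∈ Set.range (bdIncl n) then
    ⟨.inl (h.base ⟨p.1, hp.choose⟩), h.fiberMap ⟨p.1, hp.choose⟩⟩
  else ⟨.inr ⟨p.1, p.2, hp⟩, 𝟙 _⟩

/-- The sphere point chosen in `attachCell` is the given one, since `bdIncl` is injective. -/
theorem attachCell_bdIncl (c : C) (s : BdSphere n) :
    attachCell B h ⟨c, bdIncl n s⟩ = ⟨.inl (h.base ⟨c, s⟩), h.fiberMap ⟨c, s⟩⟩ := by
  have hp : bdIncl n s ∈ Set.range (bdIncl n) := ⟨s, rfl⟩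
  have hs : hp.choose = s := (isClosedEmbedding_bdIncl n).injective hp.choose_spec
  unfold attachCell
  rw [dif_pos hp]
  rw [hs]

theorem attachCell_of_notMem (c : C) (e : Disk n) (he : e ∉ Set.range (bdIncl n)) :
    attachCell B h ⟨c, e⟩ = ⟨.inr ⟨c, e, he⟩, 𝟙 _⟩ := dif_neg he

/-- The map from `B` to the attached space. -/
noncomputable def attachInlSet : PreMap B (attachSet (n := n) B V) :=
  PreMap.ofFiber (Y := attachSet (n := n) B V) (fun b => .inl b) fun _ => 𝟙 _

/-- The map from the cells to the attached space. -/
noncomputable def attachInrSet :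
    PreMap (cells V (Disk n)).toPreFamily (attachSet (n := n) B V) :=
  PreMap.ofFiber (Y := attachSet (n := n) B V) (fun p => (attachCell B h p).1)
    fun p => (attachCell B h p).2

/-- The space obtained by attaching cells to `B`, with the push-out topology. -/
noncomputable def attach : PreFamily 𝒱 :=
  { attachSet (n := n) B V with
    topTotal := TopologicalSpace.coinduced (attachInlSet B (n := n)).toFun inferInstance ⊔
      TopologicalSpace.coinduced (attachInrSet B h).toFun inferInstance
    topBase := TopologicalSpace.coinduced (attachInlSet B (V := V) (n := n)).base inferInstance ⊔
      TopologicalSpace.coinduced (attachInrSet B h).base inferInstance }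

/-- The map from `B` to the attached space. -/
noncomputable def attachInl : PreMap B (attach B h) :=
  PreMap.ofFiber (Y := attach B h) (fun b => .inl b) fun _ => 𝟙 _

/-- The map from the cells to the attached space. -/
noncomputable def attachInr : PreMap (cells V (Disk n)).toPreFamily (attach B h) :=
  PreMap.ofFiber (Y := attach B h) (fun p => (attachCell B h p).1) fun p => (attachCell B h p).2

theorem isGlued_attach : IsGlued (attachInl B h) (attachInr B h) where
  base_injective := Sum.inl_injective
  isIso_fiberMap b := by
    have hm : (attachInl B h).fiberMap b = 𝟙 _ :=
      PreMap.ofFiber_fiberMap (Y := attach B h) _ _ b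
    rw [hm]
    exact inferInstanceAs (IsIso (𝟙 (B.fiber b)))
  char_injective := by
    rintro ⟨c, e⟩ ⟨c', e'⟩ hp hq hpq
    change (attachCell B h _).1 = (attachCell B h _).1 at hpq
    rw [attachCell_of_notMem B h c e hp, attachCell_of_notMem B h c' e' hq] at hpq
    cases hpq
    rfl
  isIso_char := by
    intro p hp
    have hm : (attachInr B h).fiberMap p = (attachCell B h p).2 :=
      PreMap.ofFiber_fiberMap (Y := attach B h) _ _ p
    rw [hm]
    -- The target of the morphism varies with the base point, so the whole pair is generalized
    -- before the equation is substituted.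
    suffices ∀ q : Σ b : AttachBase B C n, (V p.1 ⟶ attachFiber B V b),
      q = ⟨.inr ⟨p.1, p.2, hp⟩, 𝟙 _⟩ → IsIso q.2 from this _ (attachCell_of_notMem B h p.1 p.2 hp)
    rintro _ rfl
    exact inferInstanceAs (IsIso (𝟙 (V p.1)))
  char_mem_range := by
    rintro ⟨c, e⟩ b hb
    by_contra hp
    change (attachCell B h _).1 = Sum.inl b at hb
    rw [attachCell_of_notMem B h c e hp] at hb
    cases hb
  cover := by
    rintro (b | ⟨c, e, he⟩)
    · exact Or.inl ⟨b, rfl⟩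
    · exact Or.inr ⟨⟨c, e⟩, he, congrArg Sigma.fst (attachCell_of_notMem B h c e he)⟩
  topTotal_eq := rfl
  topBase_eq := rfl

theorem attach_comm :
    h.comp (attachInl B h) = (cellsMap V (bdIncl n)).toPreMap.comp (attachInr B h) := by
  refine PreMap.ext_toFun fun x => ?_
  obtain ⟨p, v, rfl⟩ := (cells V (BdSphere n)).exists_pt x
  calc (attachInl B h).toFun (h.toFun ((cells V (BdSphere n)).pt p v))
      = (attachInl B h).toFun (B.pt (h.base p) (lin (h.fiberMap p) v)) :=
        congrArg _ (h.toFun_pt p v)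
    _ = (attach B h).pt (.inl (h.base p)) (lin (h.fiberMap p) v) :=
        PreMap.ofFiber_pt (Y := attach B h) _ _ _ _
    _ = (attach B h).pt (attachCell B h ⟨p.1, bdIncl n p.2⟩).1
          (lin (attachCell B h ⟨p.1, bdIncl n p.2⟩).2 v) := by
        rw [attachCell_bdIncl]
        rfl
    _ = (attachInr B h).toFun ((cells V (Disk n)).pt ⟨p.1, bdIncl n p.2⟩ v) :=
        (PreMap.ofFiber_pt (X := (cells V (Disk n)).toPreFamily) (Y := attach B h)
          (fun p => (attachCell B h p).1) (fun p => (attachCell B h p).2) ⟨p.1, bdIncl n p.2⟩ v).symm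

end Attach

/-- Being glued is invariant under isomorphism of families; this carries it from the explicit model
to an arbitrary push-out. -/
theorem IsGlued.comp_iso {B P Q : PreFamily 𝒱} {C : Type u} {V : C → 𝒱.Obj} {n : ℕ}
    {j : PreMap B P} {Φ : PreMap (cells V (Disk n)).toPreFamily P} (g : IsGlued j Φ)
    {f : PreMap P Q} {f' : PreMap Q P} (hf : f.IsContinuous) (hf' : f'.IsContinuous)
    (h₁ : f.comp f' = PreMap.id P) (h₂ : f'.comp f = PreMap.id Q) :
    IsGlued (j.comp f) (Φ.comp f) := by
  have hb : Function.LeftInverse f'.base f.base := congrFun (congrArg PreMap.base h₁)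
  have hb' : Function.RightInverse f'.base f.base := congrFun (congrArg PreMap.base h₂)
  have ht : Function.LeftInverse f'.toFun f.toFun := congrFun (congrArg PreMap.toFun h₁)
  have ht' : Function.RightInverse f'.toFun f.toFun := congrFun (congrArg PreMap.toFun h₂)
  have hi := PreMap.isIso_fiberMap h₁ h₂
  refine ⟨hb.injective.comp g.base_injective, fun b => ?_, fun p q hp hq e =>
    g.char_injective p q hp hq (hb.injective e), fun p hp => ?_, fun p b e =>
    g.char_mem_range p b (hb.injective e), fun b => ?_, ?_, ?_⟩
  · rw [PreMap.comp_fiberMap]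
    have := g.isIso_fiberMap b
    have := hi (j.base b)
    exact inferInstanceAs (IsIso (j.fiberMap b ≫ f.fiberMap (j.base b)))
  · rw [PreMap.comp_fiberMap]
    have := g.isIso_char p hp
    have := hi (Φ.base p)
    exact inferInstanceAs (IsIso (Φ.fiberMap p ≫ f.fiberMap (Φ.base p)))
  · rw [← hb' b]
    rcases g.cover (f'.base b) with ⟨b₀, e⟩ | ⟨p, hp, e⟩
    · exact Or.inl ⟨b₀, congrArg f.base e⟩
    · exact Or.inr ⟨p, hp, congrArg f.base e⟩
  · exact topology_eq_of_glue_comp g.topTotal_eq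
      (Homeomorph.mk ⟨f.toFun, f'.toFun, ht, ht'⟩ hf.1 hf'.1)
  · exact topology_eq_of_glue_comp g.topBase_eq
      (Homeomorph.mk ⟨f.base, f'.base, hb, hb'⟩ hf.2 hf'.2)

/-- Push-outs along `Z × S^(n-1) → Z × D^n` in the category of families are obtained by attaching
cells. -/
theorem isGlued_of_isPushout {B P : VFamily 𝒱} {C : Type u} {V : C → 𝒱.Obj} {n : ℕ} {j : B ⟶ P}
    {Φ : cells V (Disk n) ⟶ P} {h : cells V (BdSphere n) ⟶ B}
    (H : IsPushout h (cellsMap V (bdIncl n)) j Φ) :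
    IsGlued (VMap.toPreMap j) (VMap.toPreMap Φ) := by
  have g := isGlued_attach B.toPreFamily (VMap.toPreMap h)
  let Q : VFamily 𝒱 := ⟨attach B.toPreFamily (VMap.toPreMap h),
    g.isFamily B.isFamily (VMap.isContinuous h) (attach_comm _ _)⟩
  let j' : B ⟶ Q := VMap.mk (Y := Q) (attachInl _ _) g.continuous_left
  let Φ' : cells V (Disk n) ⟶ Q := VMap.mk (Y := Q) (attachInr _ _) g.continuous_right
  have H' : IsPushout h (cellsMap V (bdIncl n)) j' Φ' :=
    IsGlued.isPushout (j := j') (Φ := Φ') g (VMap.ext_toPreMap (attach_comm _ _))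
  -- The explicit model is also a push-out of the same span, hence uniquely isomorphic to `P`.
  let i := H'.isoIsPushout _ _ H
  have := g.comp_iso (VMap.isContinuous i.hom) (VMap.isContinuous i.inv)
    (congrArg VMap.toPreMap i.hom_inv_id) (congrArg VMap.toPreMap i.inv_hom_id)
  convert this using 1
  · exact congrArg VMap.toPreMap (H'.inl_isoIsPushout_hom _ _ H).symm
  · exact congrArg VMap.toPreMap (H'.inr_isoIsPushout_hom _ _ H).symm

/-! ## Continuous extension of a functor to the closure of a structure category -/

section ModuleTopology

variable (M : Type*) [AddCommGroup M] [Module ℝ M] [TopologicalSpace M] [IsModuleTopology ℝ M]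
  [Module.Finite ℝ M]

theorem IsModuleTopology.exists_homeomorph_pi : ∃ n : ℕ, Nonempty (M ≃ₜ (Fin n → ℝ)) := by
  let e := (Module.finBasis ℝ M).equivFun
  have : ContinuousAdd M := IsModuleTopology.toContinuousAdd ℝ M
  have : ContinuousSMul ℝ M := IsModuleTopology.toContinuousSMul ℝ M
  exact ⟨_, ⟨⟨e.toEquiv, IsModuleTopology.continuous_of_linearMap e.toLinearMap,
    IsModuleTopology.continuous_of_linearMap e.symm.toLinearMap⟩⟩⟩

theorem IsModuleTopology.t2Space_real : T2Space M := by
  obtain ⟨n, ⟨e⟩⟩ := exists_homeomorph_pi M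
  exact e.symm.t2Space

theorem IsModuleTopology.locallyCompactSpace_real : LocallyCompactSpace M := by
  obtain ⟨n, ⟨e⟩⟩ := exists_homeomorph_pi M
  exact e.isClosedEmbedding.locallyCompactSpace

theorem IsModuleTopology.secondCountableTopology_real : SecondCountableTopology M := by
  obtain ⟨n, ⟨e⟩⟩ := exists_homeomorph_pi M
  exact e.secondCountableTopology

end ModuleTopology

instance (V : FGModuleCat.{u} ℝ) : T2Space V := IsModuleTopology.t2Space_real V

instance (V : FGModuleCat.{u} ℝ) : LocallyCompactSpace V :=
  IsModuleTopology.locallyCompactSpace_real V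

instance (V : FGModuleCat.{u} ℝ) : SecondCountableTopology V :=
  IsModuleTopology.secondCountableTopology_real V

/-! ### Topology of spaces of linear maps -/

section LinTopology

variable {V W : FGModuleCat.{u} ℝ}

/-- The standard topology of a space of linear maps. -/
@[reducible] def linTopology (V W : FGModuleCat.{u} ℝ) : TopologicalSpace (V →ₗ[ℝ] W) :=
  moduleTopology ℝ _

attribute [local instance] linTopology

instance : IsModuleTopology ℝ (V →ₗ[ℝ] W) := ⟨rfl⟩

theorem continuous_linearMap_apply : Continuous fun p : (V →ₗ[ℝ] W) × V => p.1 p.2 :=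
  IsModuleTopology.continuous_bilinear_of_finite_left
    (LinearMap.id : (V →ₗ[ℝ] W) →ₗ[ℝ] V →ₗ[ℝ] W)

/-- Evaluation at a spanning family embeds the space of linear maps. -/
theorem isClosedEmbedding_eval {ι : Type*} [Finite ι] {v : ι → V}
    (hv : Submodule.span ℝ (Set.range v) = ⊤) :
    IsClosedEmbedding fun (g : V →ₗ[ℝ] W) i => g (v i) := by
  have := IsModuleTopology.t2Space_real (V →ₗ[ℝ] W)
  have : ContinuousAdd (V →ₗ[ℝ] W) := IsModuleTopology.toContinuousAdd ℝ _
  have : ContinuousSMul ℝ (V →ₗ[ℝ] W) := IsModuleTopology.toContinuousSMul ℝ _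
  have : IsTopologicalAddGroup (V →ₗ[ℝ] W) := IsModuleTopology.topologicalAddGroup ℝ _
  have : IsTopologicalAddGroup W := IsModuleTopology.topologicalAddGroup ℝ _
  let f : (V →ₗ[ℝ] W) →ₗ[ℝ] (ι → W) := LinearMap.pi fun i => LinearMap.applyₗ (v i)
  refine LinearMap.isClosedEmbedding_of_injective (f := f) (LinearMap.ker_eq_bot.2 ?_)
  intro g g' h
  exact LinearMap.ext_on_range hv (congrFun h)

end LinTopology

/-! ### Extension of `ψ` to the closures of the hom-sets -/

/-- A continuous extension of `ψ` to the closures of the hom-sets of `𝒱`, with values in linear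
maps. -/
structure ClosureExtension (ψ : 𝒱.Obj ⥤ 𝒲.Obj) where
  E : ∀ {V W : 𝒱.Obj}, (𝒱.toClosure.obj V ⟶ 𝒱.toClosure.obj W) →
    ((ψ.obj V).vect →ₗ[ℝ] (ψ.obj W).vect)
  continuous_E : ∀ V W : 𝒱.Obj, Continuous
    fun p : (𝒱.toClosure.obj V ⟶ 𝒱.toClosure.obj W) × ψ.obj V => E p.1 p.2
  E_map : ∀ {V W : 𝒱.Obj} (m : V ⟶ W), E (𝒱.toClosure.map m) = lin (ψ.map m)
  E_comp : ∀ {U V W : 𝒱.Obj} (g : 𝒱.toClosure.obj U ⟶ 𝒱.toClosure.obj V) (m : V ⟶ W),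
    E (g ≫ 𝒱.toClosure.map m) = lin (ψ.map m) ∘ₗ E g

theorem continuous_lin_apply {V W : 𝒱.Obj} : Continuous fun p : (V ⟶ W) × V => lin p.1 p.2 :=
  let _ := linTopology V.vect W.vect
  continuous_linearMap_apply.comp (((continuous_induced_dom (f := lin)).comp
    continuous_fst).prodMk continuous_snd)

/-- Closed hom-sets equal their closures, so `ψ` is its own extension. -/
theorem nonempty_closureExtension_of_closed {ψ : 𝒱.Obj ⥤ 𝒲.Obj} (hψ : IsContinuousFunctor ψ)
    (h : 𝒱.IsClosedSubcategory) : Nonempty (ClosureExtension ψ) := by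
  have hm : ∀ {V W : 𝒱.Obj} (g : 𝒱.toClosure.obj V ⟶ 𝒱.toClosure.obj W),
      g.1 ∈ 𝒱.hom V.toObj W.toObj := fun {V W} g =>
    (@IsClosed.closure_eq _ (linTopology _ _) _ (h V.toObj W.toObj)).subset g.2
  let r : ∀ {V W : 𝒱.Obj}, (𝒱.toClosure.obj V ⟶ 𝒱.toClosure.obj W) → (V ⟶ W) :=
    fun g => ⟨g.1, hm g⟩
  refine ⟨⟨fun g => lin (ψ.map (r g)), fun V W => ?_, fun m => rfl, fun g m => ?_⟩⟩
  · have hr : Continuous (r : (𝒱.toClosure.obj V ⟶ 𝒱.toClosure.obj W) → (V ⟶ W)) :=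
      continuous_induced_rng.2 continuous_induced_dom
    exact continuous_lin_apply.comp
      ((((hψ V W).comp hr).comp continuous_fst).prodMk continuous_snd)
  · rw [← lin_comp, ← ψ.map_comp]
    rfl

/-- The equality of functors identifies `ψ' V` with `ψ V` only up to `eqToIso`; conjugating `ψ'`
with this isomorphism gives maps between the right spaces. -/
theorem nonempty_closureExtension_of_regular {ψ : 𝒱.Obj ⥤ 𝒲.Obj} (h : IsRegularFunctor ψ) :
    Nonempty (ClosureExtension ψ) := by
  obtain ⟨ψ', hψ', e⟩ := h
  let α := eqToIso e
  let r : ∀ {V W : 𝒱.Obj}, (𝒱.toClosure.obj V ⟶ 𝒱.toClosure.obj W) →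
    (𝒲.toClosure.obj (ψ.obj V) ⟶ 𝒲.toClosure.obj (ψ.obj W)) :=
    fun {V W} g => α.hom.app V ≫ ψ'.map g ≫ α.inv.app W
  have hr : ∀ {V W : 𝒱.Obj} (m : V ⟶ W), r (𝒱.toClosure.map m) = 𝒲.toClosure.map (ψ.map m) := by
    intro V W m
    exact (NatIso.naturality_1 α.symm m)
  refine ⟨⟨fun g => lin (𝒱 := 𝒲.closureCat) (r g), fun V W => ?_, fun m => ?_, fun {U V W} g m => ?_⟩⟩
  · exact (IsModuleTopology.continuous_of_linearMap (lin (α.inv.app W))).comp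
      (continuous_lin_apply.comp (((hψ' _ _).comp continuous_fst).prodMk
        ((IsModuleTopology.continuous_of_linearMap (lin (α.hom.app V))).comp continuous_snd)))
  · change lin (𝒱 := 𝒲.closureCat) (r _) = _
    rw [hr]
    rfl
  · have : r (g ≫ 𝒱.toClosure.map m) = r g ≫ r (𝒱.toClosure.map m) := by
      simp [r]
    change lin (𝒱 := 𝒲.closureCat) (r _) = _
    rw [this, hr]
    rfl

theorem nonempty_closureExtension {ψ : 𝒱.Obj ⥤ 𝒲.Obj} (hψ : IsContinuousFunctor ψ)
    (hreg : (𝒱.IsClosedSubcategory ∧ 𝒲.IsClosedSubcategory) ∨ IsRegularFunctor ψ) :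
    Nonempty (ClosureExtension ψ) :=
  hreg.elim (fun h => nonempty_closureExtension_of_closed hψ h.1)
    nonempty_closureExtension_of_regular

/-- The linear map underlying a morphism of the closure. -/
def closureLin {V W : 𝒱.Obj} (g : 𝒱.toClosure.obj V ⟶ 𝒱.toClosure.obj W) :
    V.vect →ₗ[ℝ] W.vect := g.1

/-- Evaluation at a spanning family embeds the hom-sets of a closure. -/
theorem isClosedEmbedding_closureLin {V W : 𝒱.Obj} {ι : Type*} [Finite ι] {v : ι → V}
    (hv : Submodule.span ℝ (Set.range v) = ⊤) :
    IsClosedEmbedding fun (g : 𝒱.toClosure.obj V ⟶ 𝒱.toClosure.obj W) i => closureLin g (v i) := by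
  let _ := linTopology V.vect W.vect
  exact (isClosedEmbedding_eval (W := W.vect) hv).comp
    (IsClosed.isClosedEmbedding_subtypeVal (isClosed_closure (s := 𝒱.hom V.toObj W.toObj)))

/-! ## Extending open sets from the boundary -/

/-- An open subset of a nice space is exhausted by the interiors of an increasing sequence of
compact subsets. -/
theorem exists_compact_exhaustion_of_isOpen {Y : Type*} [TopologicalSpace Y]
    [LocallyCompactSpace Y] [SecondCountableTopology Y] {U : Set Y} (hU : IsOpen U) :
    ∃ K : ℕ → Set Y, (∀ m, IsCompact (K m)) ∧ Monotone K ∧ (∀ m, K m ⊆ U) ∧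
      ∀ y ∈ U, ∃ m, y ∈ interior (K m) := by
  have : LocallyCompactSpace U := hU.locallyCompactSpace
  let E : CompactExhaustion U := default
  refine ⟨fun m => Subtype.val '' E m, fun m => (E.isCompact m).image continuous_subtype_val,
    fun m m' h => Set.image_mono (E.subset h), fun m => Subtype.coe_image_subset _ _,
    fun y hy => ?_⟩
  obtain ⟨m, hm⟩ := E.exists_mem ⟨y, hy⟩
  refine ⟨m + 1, ?_⟩
  have h : Subtype.val '' interior (E (m + 1)) ⊆ interior (Subtype.val '' E (m + 1)) :=
    interior_maximal (Set.image_mono interior_subset)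
      (hU.isOpenMap_subtype_val _ isOpen_interior)
  exact h ⟨⟨y, hy⟩, E.subset_interior_succ m hm, rfl⟩

/-- Open sets `Y i` of `D × Z` can be shrunk, without change where `δ = 0`, such that a condition
on points `(e, h)` that holds where `δ e = 0` and all `(e, ev i h)` lie in `Y i` holds wherever
all `(e, ev i h)` lie in the shrunken sets. -/
theorem exists_isOpen_shrink {ι D Z H : Type*} [Finite ι] [Nonempty ι] [TopologicalSpace D]
    [TopologicalSpace Z] [TopologicalSpace H] [CompactSpace D] [T2Space D]
    [SecondCountableTopology D] [T2Space Z] [LocallyCompactSpace Z] [SecondCountableTopology Z]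
    {δ : D → ℝ} (hδ : Continuous δ) (hδ₀ : ∀ e, 0 ≤ δ e) {ev : ι → H → Z}
    (hev : ∀ i, Continuous (ev i))
    (hproper : ∀ K : Set Z, IsCompact K → IsCompact {h | ∀ i, ev i h ∈ K})
    {Y : ι → Set (D × Z)} (hY : ∀ i, IsOpen (Y i)) {O : Set (D × H)} (hO : IsOpen O)
    (hYO : ∀ e h, δ e = 0 → (∀ i, (e, ev i h) ∈ Y i) → (e, h) ∈ O) :
    ∃ W : ι → Set (D × Z), (∀ i, IsOpen (W i)) ∧
      (∀ i e z, δ e = 0 → ((e, z) ∈ W i ↔ (e, z) ∈ Y i)) ∧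
      ∀ e h, (∀ i, (e, ev i h) ∈ W i) → (e, h) ∈ O := by
  choose K hKc hKm hKY hK using fun i => exists_compact_exhaustion_of_isOpen (hY i)
  let L : ℕ → Set (D × H) := fun m => {p | ∀ i, (p.1, ev i p.2) ∈ K i m}
  have hL : ∀ m, IsCompact (L m) := by
    intro m
    -- All values `ev i h` of points of `L m` lie in one compact subset of `Z`, so properness bounds
    -- the `H`-coordinate.
    have hc : IsCompact (⋃ i, Prod.snd '' K i m) :=
      isCompact_iUnion fun i => (hKc i m).image continuous_snd
    refine ((isCompact_univ (X := D)).prod (hproper _ hc)).of_isClosed_subset ?_ ?_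
    · simp only [L, Set.ofPred_forall]
      exact isClosed_iInter fun i => (hKc i m).isClosed.preimage
        (continuous_fst.prodMk ((hev i).comp continuous_snd))
    · exact fun p hp => ⟨trivial, fun i => Set.mem_iUnion.2 ⟨i, _, hp i, rfl⟩⟩
  -- The bad points of `L m` form a compact set on which `δ` is positive: where `δ` vanishes the
  -- hypothesis puts the point in `O`.
  have hε : ∀ m, ∃ ε, 0 < ε ∧ ∀ p ∈ L m \ O, ε ≤ δ p.1 := fun m =>
    ((hL m).diff hO).exists_forall_le' (hδ.comp continuous_fst).continuousOn fun p hp =>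
      lt_of_le_of_ne (hδ₀ _) fun h => hp.2 (hYO p.1 p.2 h.symm fun i => hKY i m (hp.1 i))
  choose ε hε₀ hε using hε
  refine ⟨fun i => ⋃ m, interior (K i m) ∩ {p | δ p.1 < ε m}, fun i => isOpen_iUnion fun m =>
    isOpen_interior.inter (isOpen_lt (hδ.comp continuous_fst) continuous_const),
    fun i e z he => ⟨fun h => ?_, fun h => ?_⟩, fun e h hh => ?_⟩
  · obtain ⟨m, hm, -⟩ := Set.mem_iUnion.1 h
    exact hKY i m (interior_subset hm)
  · obtain ⟨m, hm⟩ := hK i _ h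
    exact Set.mem_iUnion.2 ⟨m, hm, by simpa [he] using hε₀ m⟩
  · simp only [Set.mem_iUnion] at hh
    choose m hm using hh
    -- The indices `m i` may differ. At the largest one all values lie in the monotone compact sets,
    -- while `δ e` is still below the matching bound.
    obtain ⟨i₀, hi₀⟩ := Finite.exists_max m
    by_contra hn
    exact absurd (hε (m i₀) (e, h) ⟨fun i => hKm i (hi₀ i) (interior_subset (hm i).1), hn⟩)
      (not_le.2 (hm i₀).2)

/-! ## The cell structure of a complex -/

section Restrict

variable {A X : PreFamily 𝒱}

/-- A map whose base map has values in `S`, as a map into the restriction to `S`. -/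
def PreMap.lift (f : PreMap A X) (S : Set X.Base) (h : ∀ b, f.base b ∈ S) :
    PreMap A (restrictPre X S) where
  toFun x := ⟨f.toFun x, Set.mem_of_eq_of_mem (f.comm x) (h _)⟩
  base b := ⟨f.base b, h b⟩
  comm x := Subtype.ext (f.comm x)
  fiber_mem b := f.fiber_mem b

/-- The inclusion of a restriction in a larger one. -/
def restrictIncl (X : PreFamily 𝒱) {S T : Set X.Base} (h : S ⊆ T) :
    PreMap (restrictPre X S) (restrictPre X T) where
  toFun x := ⟨x.1, h x.2⟩
  base b := ⟨b.1, h b.2⟩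
  comm _ := rfl
  fiber_mem _ := ⟨𝟙 _, fun _ => rfl⟩

theorem restrictIncl_fiberMap {S T : Set X.Base} (h : S ⊆ T) (b : S) :
    (restrictIncl X h).fiberMap b = 𝟙 (X.fiber b) :=
  PreMap.fiberMap_eq (restrictIncl X h) (m := 𝟙 (X.fiber b)) fun _ => rfl

end Restrict

namespace VComplex

variable (X : VComplex 𝒱)

theorem isGlued (n : ℕ) : IsGlued (restrictIncl X.toPreFamily (X.isComplex.skel_succ n))
    ((X.cells.char n).lift (X.cells.skel (n + 1)) (X.isComplex.char_mem n)) :=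
  isGlued_of_isPushout (X.isComplex.isPushout n)

theorem skel_mono : Monotone X.cells.skel := monotone_nat_of_le_succ X.isComplex.skel_succ

theorem exists_mem_skel (b : X.Base) : ∃ n, b ∈ X.cells.skel n :=
  Set.mem_iUnion.1 (X.isComplex.iUnion_skel ▸ Set.mem_univ b)

/-- The image of the point `e` of the cell `c` in the base. -/
def charBase {n : ℕ} (c : X.cells.Cell n) (e : Disk n) : X.Base := (X.cells.char n).base ⟨c, e⟩

/-- The morphism that the characteristic map induces on the fibre over the point `e` of the
cell `c`. -/
noncomputable def charMor {n : ℕ} (c : X.cells.Cell n) (e : Disk n) :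
    X.cells.cellFiber n c ⟶ X.fiber (X.charBase c e) := (X.cells.char n).fiberMap ⟨c, e⟩

/-- The characteristic map on a single cell. -/
def charFun {n : ℕ} (c : X.cells.Cell n) (p : Disk n × X.cells.cellFiber n c) : X.Total :=
  (X.cells.char n).toFun ⟨c, p⟩

variable {X} {n : ℕ}

theorem charFun_eq (c : X.cells.Cell n) (p : Disk n × X.cells.cellFiber n c) :
    X.charFun c p = X.pt (X.charBase c p.1) (lin (X.charMor c p.1) p.2) :=
  (X.cells.char n).toFun_pt ⟨c, p.1⟩ p.2

@[simp] theorem proj_charFun (c : X.cells.Cell n) (p : Disk n × X.cells.cellFiber n c) :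
    X.proj (X.charFun c p) = X.charBase c p.1 := (X.cells.char n).comm _

theorem charBase_mem_skel (c : X.cells.Cell n) (e : Disk n) :
    X.charBase c e ∈ X.cells.skel (n + 1) := X.isComplex.char_mem n _

theorem charBase_mem_skel_iff {c : X.cells.Cell n} {e : Disk n} :
    X.charBase c e ∈ X.cells.skel n ↔ e ∈ Set.range (bdIncl n) := by
  constructor
  · exact fun h => (X.isGlued n).char_mem_range ⟨c, e⟩ ⟨_, h⟩ rfl
  · rintro ⟨s, rfl⟩
    exact X.isComplex.attach_mem n ⟨c, s⟩

theorem isIso_charMor {c : X.cells.Cell n} {e : Disk n} (he : e ∉ Set.range (bdIncl n)) :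
    IsIso (X.charMor c e) :=
  (X.isGlued n).isIso_char ⟨c, e⟩ he

theorem mem_skel_succ {b : X.Base} (hb : b ∈ X.cells.skel (n + 1)) : b ∈ X.cells.skel n ∨
    ∃ c e, e ∉ Set.range (bdIncl n) ∧ X.charBase (n := n) c e = b := by
  rcases (X.isGlued n).cover ⟨b, hb⟩ with ⟨b₀, h⟩ | ⟨p, hp, h⟩
  · have h' : b₀.1 = b := congrArg Subtype.val h
    exact Or.inl (h' ▸ b₀.2)
  · exact Or.inr ⟨p.1, p.2, hp, congrArg Subtype.val h⟩

theorem charFun_injective {c c' : X.cells.Cell n} {p : Disk n × X.cells.cellFiber n c}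
    {p' : Disk n × X.cells.cellFiber n c'} (hp : p.1 ∉ Set.range (bdIncl n))
    (hp' : p'.1 ∉ Set.range (bdIncl n)) (h : X.charFun c p = X.charFun c' p') :
    (⟨c, p⟩ : Σ c, Disk n × X.cells.cellFiber n c) = ⟨c', p'⟩ :=
  (X.isGlued n).char_toFun_injective ⟨c, p⟩ ⟨c', p'⟩ (mt mem_range_cellsMap_toFun.1 hp)
    (mt mem_range_cellsMap_toFun.1 hp') (Subtype.ext h)

/-- The first skeleton containing `b` adds it as an interior point of a cell. -/
theorem exists_char_of_mem_skel {b : X.Base} (hb : b ∈ X.cells.skel n) :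
    ∃ k < n, b ∉ X.cells.skel k ∧ ∃ c e, e ∉ Set.range (bdIncl k) ∧
      X.charBase (n := k) c e = b := by
  induction n with
  | zero => exact absurd hb (X.isComplex.skel_zero ▸ Set.notMem_empty b)
  | succ n ih =>
    by_cases h : b ∈ X.cells.skel n
    · obtain ⟨k, hk, h'⟩ := ih h
      exact ⟨k, hk.trans n.lt_succ_self, h'⟩
    · exact ⟨n, n.lt_succ_self, h, (mem_skel_succ hb).resolve_left h⟩

theorem continuous_charFun (c : X.cells.Cell n) : Continuous (X.charFun c) :=
  (X.isComplex.char_continuous n).1.comp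
    (continuous_sigmaMk (σ := fun c => Disk n × X.cells.cellFiber n c))

/-- The push-out topologies unwind inductively, so openness over a skeleton is tested on its cells.
-/
theorem isOpen_skel_of_char {S : Set X.Total}
    (h : ∀ k < n, ∀ c : X.cells.Cell k, IsOpen (X.charFun c ⁻¹' S)) :
    IsOpen (Subtype.val ⁻¹' S : Set {x : X.Total // X.proj x ∈ X.cells.skel n}) := by
  induction n with
  | zero =>
    convert isOpen_empty
    ext x
    exact (X.isComplex.skel_zero ▸ x.2 : X.proj x.1 ∈ (∅ : Set X.Base)).elim
  | succ n ih =>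
    exact (isOpen_iff_of_glue (X.isGlued n).topTotal_eq).2
      ⟨ih fun k hk => h k (hk.trans n.lt_succ_self), isOpen_sigma_iff.2 (h n n.lt_succ_self)⟩

theorem isOpen_of_char {S : Set X.Total}
    (h : ∀ k, ∀ c : X.cells.Cell k, IsOpen (X.charFun c ⁻¹' S)) : IsOpen S := by
  rw [← isClosed_compl_iff]
  exact X.isComplex.isClosed_total _ fun n =>
    isClosed_compl_iff.2 (isOpen_skel_of_char fun k _ => h k)

/-- The attaching map is continuous into the lower skeleton, whose topology is detected by cells of
smaller dimension. This supplies the boundary data for extension over the cell. -/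
theorem isOpen_boundary_of_char {S : Set X.Total}
    (h : ∀ k < n, ∀ c : X.cells.Cell k, IsOpen (X.charFun c ⁻¹' S)) (c : X.cells.Cell n) :
    IsOpen {p : BdSphere n × X.cells.cellFiber n c | X.charFun c (bdIncl n p.1, p.2) ∈ S} := by
  have hc : Continuous fun p : BdSphere n × X.cells.cellFiber n c =>
      X.charFun c (bdIncl n p.1, p.2) :=
    (continuous_charFun c).comp
      (((bdIncl n).continuous.comp continuous_fst).prodMk continuous_snd)
  refine (isOpen_skel_of_char h).preimage (hc.subtype_mk fun p => ?_)
  rw [proj_charFun]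
  exact charBase_mem_skel_iff.2 ⟨p.1, rfl⟩

end VComplex

/-! ## Neighbourhoods in function spaces -/

namespace VComplex

variable {X : VComplex 𝒱} {V : 𝒱.Obj} {ι : Type*} {v : ι → V}
  {O : ∀ b : X.Base, Set (𝒱.toClosure.obj V ⟶ 𝒱.toClosure.obj (X.fiber b))}

/-- A set of maps `V → X` is open on the cells of dimension `k`. -/
def IsOpenOnCells (O : ∀ b : X.Base, Set (𝒱.toClosure.obj V ⟶ 𝒱.toClosure.obj (X.fiber b)))
    (k : ℕ) : Prop :=
  ∀ c : X.cells.Cell k,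
    IsOpen {p : Disk k × (𝒱.toClosure.obj V ⟶ 𝒱.toClosure.obj (X.cells.cellFiber k c)) |
      p.2 ≫ 𝒱.toClosure.map (X.charMor c p.1) ∈ O (X.charBase c p.1)}

/-- Open subsets `U i` of a skeleton such that maps `a` over the skeleton with `a (v i) ∈ U i` for
all `i` lie in `O`. -/
structure IsOpenStage (v : ι → V)
    (O : ∀ b : X.Base, Set (𝒱.toClosure.obj V ⟶ 𝒱.toClosure.obj (X.fiber b))) (n : ℕ)
    (U : ι → Set X.Total) : Prop where
  proj_mem : ∀ i, ∀ x ∈ U i, X.proj x ∈ X.cells.skel n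
  isOpen : ∀ i, ∀ k < n, ∀ c : X.cells.Cell k, IsOpen (X.charFun c ⁻¹' U i)
  mem : ∀ m ≤ n, (∀ k < m, IsOpenOnCells O k) → ∀ b ∈ X.cells.skel m,
    ∀ a : 𝒱.toClosure.obj V ⟶ 𝒱.toClosure.obj (X.fiber b),
      (∀ i, X.pt b (closureLin a (v i)) ∈ U i) → a ∈ O b

theorem pt_comp_charMor {n : ℕ} (c : X.cells.Cell n) (e : Disk n)
    (g : 𝒱.toClosure.obj V ⟶ 𝒱.toClosure.obj (X.cells.cellFiber n c)) (w : V) :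
    X.pt (X.charBase c e) (closureLin (g ≫ 𝒱.toClosure.map (X.charMor c e)) w) =
      X.charFun c (e, closureLin g w) :=
  (charFun_eq c (e, closureLin g w)).symm

/-- Over interior points the characteristic map is an isomorphism on fibres, so maps into `X` there
can be read as maps into the cell. -/
theorem exists_comp_charMor {n : ℕ} {c : X.cells.Cell n} {e : Disk n}
    (he : e ∉ Set.range (bdIncl n))
    (a : 𝒱.toClosure.obj V ⟶ 𝒱.toClosure.obj (X.fiber (X.charBase c e))) :
    ∃ g, a = g ≫ 𝒱.toClosure.map (X.charMor c e) := by
  have := isIso_charMor (c := c) he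
  refine ⟨a ≫ 𝒱.toClosure.map (inv (X.charMor c e)), ?_⟩
  rw [Category.assoc, ← Functor.map_comp, IsIso.inv_hom_id, CategoryTheory.Functor.map_id, Category.comp_id]

/-- Extension of an open stage over the cells of the next dimension. -/
theorem IsOpenStage.extend {n : ℕ} {U : ι → Set X.Total} (hU : IsOpenStage v O n U)
    {W : ∀ c : X.cells.Cell n, ι → Set (Disk n × X.cells.cellFiber n c)}
    (hW : ∀ c i, IsOpen (W c i))
    (hWU : ∀ c i e z, e ∈ Set.range (bdIncl n) → ((e, z) ∈ W c i ↔ X.charFun c (e, z) ∈ U i))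
    (hWO : (∀ k < n + 1, IsOpenOnCells O k) → ∀ (c : X.cells.Cell n) e
      (g : 𝒱.toClosure.obj V ⟶ 𝒱.toClosure.obj (X.cells.cellFiber n c)),
      (∀ i, (e, closureLin g (v i)) ∈ W c i) →
        g ≫ 𝒱.toClosure.map (X.charMor c e) ∈ O (X.charBase c e)) :
    ∃ U' : ι → Set X.Total, IsOpenStage v O (n + 1) U' ∧
      (∀ i x, X.proj x ∈ X.cells.skel n → (x ∈ U' i ↔ x ∈ U i)) ∧
      ∀ c i, X.charFun c ⁻¹' U' i = W c i := by
  -- Only interior points are added; the boundary part of `W` is already accounted for by `U`.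
  let N : ι → Set X.Total := fun i =>
    {x | ∃ c, ∃ p ∈ W c i, p.1 ∉ Set.range (bdIncl n) ∧ X.charFun c p = x}
  have hN : ∀ i, ∀ x ∈ N i, X.proj x ∉ X.cells.skel n := by
    rintro i _ ⟨c, p, hp, he, rfl⟩ h
    rw [proj_charFun, charBase_mem_skel_iff] at h
    exact he h
  have hold : ∀ i x, X.proj x ∈ X.cells.skel n → (x ∈ U i ∪ N i ↔ x ∈ U i) := fun i x hx =>
    ⟨fun h => h.resolve_right fun h => hN i x h hx, Or.inl⟩
  have hnew : ∀ c i, X.charFun c ⁻¹' (U i ∪ N i) = W c i := by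
    intro c i
    ext p
    by_cases he : p.1 ∈ Set.range (bdIncl n)
    · rw [Set.mem_preimage, hold, ← hWU c i p.1 p.2 he]
      rw [proj_charFun]
      exact charBase_mem_skel_iff.2 he
    · constructor
      · rintro (h | ⟨c', p', hp', he', h⟩)
        · have := hU.proj_mem i _ h
          rw [proj_charFun, charBase_mem_skel_iff] at this
          exact absurd this he
        · cases charFun_injective he' he h
          exact hp'
      · exact fun h => Or.inr ⟨c, p, h, he, rfl⟩
  refine ⟨fun i => U i ∪ N i, ⟨?_, ?_, ?_⟩, hold, hnew⟩
  · rintro i x (h | ⟨c, p, hp, he, rfl⟩)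
    · exact X.isComplex.skel_succ n (hU.proj_mem i x h)
    · rw [proj_charFun]
      exact charBase_mem_skel c p.1
  · intro i k hk c
    rcases Nat.lt_succ_iff_lt_or_eq.1 hk with hk | rfl
    · convert hU.isOpen i k hk c using 1
      ext p
      refine hold i _ ?_
      rw [proj_charFun]
      exact X.skel_mono hk (charBase_mem_skel c p.1)
    · rw [hnew]
      exact hW c i
  · intro m hm hO b hb a ha
    by_cases hbn : b ∈ X.cells.skel n
    · rcases Nat.le_succ_iff.1 hm with hm | rfl
      · exact hU.mem m hm hO b hb a fun i => (hold i _ (by rwa [X.proj_pt])).1 (ha i)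
      · exact hU.mem n le_rfl (fun k hk => hO k (hk.trans n.lt_succ_self)) b hbn a
          fun i => (hold i _ (by rwa [X.proj_pt])).1 (ha i)
    · rcases Nat.le_succ_iff.1 hm with hm | rfl
      · exact absurd (X.skel_mono hm hb) hbn
      · obtain ⟨c, e, he, rfl⟩ := (mem_skel_succ hb).resolve_left hbn
        obtain ⟨g, rfl⟩ := exists_comp_charMor he a
        refine hWO hO c e g fun i => ?_
        rw [← hnew, Set.mem_preimage, ← pt_comp_charMor]
        exact ha i

variable [Finite ι]

/-- This is where closed hom-sets are essential: evaluation at a spanning family is then a closed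
embedding, hence proper. -/
theorem isCompact_setOf_closureLin_mem {W : 𝒱.Obj} (hv : Submodule.span ℝ (Set.range v) = ⊤)
    {K : Set W} (hK : IsCompact K) :
    IsCompact {g : 𝒱.toClosure.obj V ⟶ 𝒱.toClosure.obj W | ∀ i, closureLin g (v i) ∈ K} := by
  have h := (isClosedEmbedding_closureLin (W := W) hv).isCompact_preimage
    (isCompact_univ_pi fun _ : ι => hK)
  convert h using 1
  ext g
  simp

variable [Nonempty ι]

/-- Every open stage extends to the next skeleton. -/
theorem IsOpenStage.exists_succ (hv : Submodule.span ℝ (Set.range v) = ⊤) {n : ℕ}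
    {U : ι → Set X.Total} (hU : IsOpenStage v O n U) :
    ∃ U' : ι → Set X.Total, IsOpenStage v O (n + 1) U' ∧
      ∀ i x, X.proj x ∈ X.cells.skel n → (x ∈ U' i ↔ x ∈ U i) := by
  have hδ : ∀ e : Disk n, 1 - ‖(e : EuclideanSpace ℝ (Fin n))‖ = 0 ↔
      e ∈ Set.range (bdIncl n) := by
    intro e
    rw [sub_eq_zero]
    constructor
    · exact fun h => ⟨⟨e.1, mem_sphere_zero_iff_norm.2 h.symm⟩, rfl⟩
    · rintro ⟨s, rfl⟩
      exact (mem_sphere_zero_iff_norm.1 s.2).symm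
  have key : ∀ c : X.cells.Cell n, ∃ W : ι → Set (Disk n × X.cells.cellFiber n c),
      (∀ i, IsOpen (W i)) ∧
      (∀ i e z, e ∈ Set.range (bdIncl n) → ((e, z) ∈ W i ↔ X.charFun c (e, z) ∈ U i)) ∧
      ((∀ k < n + 1, IsOpenOnCells O k) → ∀ e
        (g : 𝒱.toClosure.obj V ⟶ 𝒱.toClosure.obj (X.cells.cellFiber n c)),
        (∀ i, (e, closureLin g (v i)) ∈ W i) →
          g ≫ 𝒱.toClosure.map (X.charMor c e) ∈ O (X.charBase c e)) := by
    intro c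
    -- The forbidden boundary points are closed in the whole cell, so the complement of `F i` is an
    -- open extension of the prescribed boundary trace of `U i`.
    let F : ι → Set (Disk n × X.cells.cellFiber n c) := fun i =>
      {p | p.1 ∈ Set.range (bdIncl n) ∧ X.charFun c p ∉ U i}
    have hF : ∀ i, IsClosed (F i) := by
      intro i
      have h₁ := ((isClosedEmbedding_bdIncl n).prodMap
        (IsClosedEmbedding.id (X := X.cells.cellFiber n c))).isClosedMap _
        (isOpen_boundary_of_char (fun k hk c => hU.isOpen i k hk c) c).isClosed_compl
      convert h₁ using 1
      ext ⟨e, z⟩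
      constructor
      · rintro ⟨⟨s, rfl⟩, h⟩
        exact ⟨(s, z), h, rfl⟩
      · rintro ⟨⟨s, z⟩, h, h'⟩
        cases h'
        exact ⟨⟨s, rfl⟩, h⟩
    have hFm : ∀ i e z, e ∈ Set.range (bdIncl n) →
        ((e, z) ∈ (F i)ᶜ ↔ X.charFun c (e, z) ∈ U i) := by
      intro i e z he
      simp only [F, Set.mem_compl_iff, Set.mem_ofPred_eq, he, true_and, not_not]
    -- If `O` is not open on the cells up to this dimension, `P` is everything and no condition is
    -- imposed. The stages can therefore continue past the skeleta on which `O` is controlled.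
    let P : Set (Disk n × (𝒱.toClosure.obj V ⟶ 𝒱.toClosure.obj (X.cells.cellFiber n c))) :=
      {p | (∀ k < n + 1, IsOpenOnCells O k) →
        p.2 ≫ 𝒱.toClosure.map (X.charMor c p.1) ∈ O (X.charBase c p.1)}
    have hP : IsOpen P := by
      by_cases hO : ∀ k < n + 1, IsOpenOnCells O k
      · simpa only [P, forall_prop_of_true hO] using hO n n.lt_succ_self c
      · simp only [P, forall_prop_of_false hO, Set.ofPred_true, isOpen_univ]
    obtain ⟨W, hW, hWF, hWP⟩ := exists_isOpen_shrink (D := Disk n)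
      (δ := fun e => 1 - ‖(e : EuclideanSpace ℝ (Fin n))‖) (by fun_prop)
      (fun e => sub_nonneg.2 (mem_closedBall_zero_iff.1 e.2))
      (ev := fun i (g : 𝒱.toClosure.obj V ⟶ 𝒱.toClosure.obj (X.cells.cellFiber n c)) =>
        closureLin g (v i))
      (fun i => (continuous_apply i).comp (isClosedEmbedding_closureLin hv).continuous)
      (fun K hK => isCompact_setOf_closureLin_mem hv hK)
      (Y := fun i => (F i)ᶜ) (fun i => (hF i).isOpen_compl) hP (by
        intro e g he hg hO
        rw [hδ] at he
        refine hU.mem n le_rfl (fun k hk => hO k (hk.trans n.lt_succ_self)) _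
          (charBase_mem_skel_iff.2 he) _ fun i => ?_
        rw [pt_comp_charMor]
        exact (hFm i _ _ he).1 (hg i))
    exact ⟨W, hW, fun i e z he => (hWF i e z ((hδ e).2 he)).trans (hFm i e z he),
      fun hO e g hg => hWP e g hg hO⟩
  choose W hW hWU hWO using key
  obtain ⟨U', h₁, h₂, -⟩ := hU.extend hW hWU fun hO c => hWO c hO
  exact ⟨U', h₁, h₂⟩

/-- Every map in `O` has an open stage around it. -/
theorem exists_isOpenStage (hv : Submodule.span ℝ (Set.range v) = ⊤) {M : ℕ}
    (hO : ∀ k < M, IsOpenOnCells O k) {b : X.Base} (hb : b ∈ X.cells.skel M)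
    {a : 𝒱.toClosure.obj V ⟶ 𝒱.toClosure.obj (X.fiber b)} (ha : a ∈ O b) :
    ∃ (n : ℕ) (U : ι → Set X.Total), IsOpenStage v O n U ∧
      ∀ i, X.pt b (closureLin a (v i)) ∈ U i := by
  obtain ⟨n, hn, -, c₀, e₀, he₀, rfl⟩ := exists_char_of_mem_skel hb
  obtain ⟨g₀, rfl⟩ := exists_comp_charMor he₀ a
  -- Below the cell containing `a`, empty sets suffice: since `ι` is nonempty no map has all its
  -- values in them.
  have h₀ : IsOpenStage v O n fun _ => (∅ : Set X.Total) :=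
    ⟨fun _ _ => False.elim, fun _ _ _ _ => isOpen_empty,
      fun _ _ _ _ _ _ h => (h (Classical.arbitrary ι)).elim⟩
  obtain ⟨A, hA, B, hB, hAB⟩ := mem_nhds_prod_iff.1 ((hO n hn c₀).mem_nhds (x := (e₀, g₀)) ha)
  obtain ⟨A', hA', hA'o, heA'⟩ := mem_nhds_iff.1 hA
  rw [(isClosedEmbedding_closureLin hv).isInducing.nhds_eq_comap, Filter.mem_comap] at hB
  obtain ⟨B', hB', hBB'⟩ := hB
  obtain ⟨S, hS, hSB⟩ := isOpen_pi_iff'.1 isOpen_interior _ (mem_interior_iff_mem_nhds.2 hB')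
  -- A product neighbourhood in the cell, kept away from the boundary so that it fits with the empty
  -- stage below.
  let W₀ : ι → Set (Disk n × X.cells.cellFiber n c₀) := fun i =>
    (A' ∩ (Set.range (bdIncl n))ᶜ) ×ˢ S i
  have key : ∀ c : X.cells.Cell n, ∃ W : ι → Set (Disk n × X.cells.cellFiber n c),
      (∀ i, IsOpen (W i)) ∧ (∀ i, ∀ p ∈ W i, p.1 ∉ Set.range (bdIncl n)) ∧
      (∀ e (g : 𝒱.toClosure.obj V ⟶ 𝒱.toClosure.obj (X.cells.cellFiber n c)),
        (∀ i, (e, closureLin g (v i)) ∈ W i) →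
          g ≫ 𝒱.toClosure.map (X.charMor c e) ∈ O (X.charBase c e)) ∧
      -- An equation of pairs says that the sets over `c₀` contain the values of `g₀`, without
      -- transport along `c = c₀`.
      ∀ i z, (⟨c₀, closureLin g₀ (v i)⟩ : Σ c, X.cells.cellFiber n c) = ⟨c, z⟩ →
        (e₀, z) ∈ W i := by
    intro c
    by_cases hc : c = c₀
    · subst hc
      refine ⟨W₀, fun i => (hA'o.inter
        (isClosedEmbedding_bdIncl n).isClosed_range.isOpen_compl).prod (hS i).1,
        fun i p hp => hp.1.2, fun e g hg => ?_, fun i z hz => ?_⟩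
      · exact hAB (Set.mk_mem_prod (hA' (hg (Classical.arbitrary ι)).1.1)
          (hBB' (show _ ∈ B' from
          interior_subset (hSB fun i _ => (hg i).2))))
      · cases hz
        exact ⟨⟨heA', he₀⟩, (hS i).2⟩
    · refine ⟨fun _ => ∅, fun _ => isOpen_empty, fun _ _ => False.elim,
        fun e g hg => (hg (Classical.arbitrary ι)).elim, fun i z hz => ?_⟩
      exact absurd (congrArg Sigma.fst hz).symm hc
  choose W hW hWi hWO hW₀ using key
  obtain ⟨U, hU, -, hUW⟩ := h₀.extend hW
    (fun c i e z he => ⟨fun h => absurd he (hWi c i _ h), False.elim⟩) fun _ => hWO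
  refine ⟨n + 1, U, hU, fun i => ?_⟩
  rw [pt_comp_charMor, ← Set.mem_preimage, hUW]
  exact hW₀ c₀ i _ rfl

/-- A set of maps `V → X` that is open on cells contains a neighbourhood of each of its points in
the topology of pointwise convergence on a spanning family. -/
theorem exists_isOpen_of_isOpenOnCells (hv : Submodule.span ℝ (Set.range v) = ⊤) {M : ℕ}
    (hO : ∀ k < M, IsOpenOnCells O k) {b : X.Base} (hb : b ∈ X.cells.skel M)
    {a : 𝒱.toClosure.obj V ⟶ 𝒱.toClosure.obj (X.fiber b)} (ha : a ∈ O b) :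
    ∃ U : ι → Set X.Total, (∀ i, IsOpen (U i)) ∧ (∀ i, X.pt b (closureLin a (v i)) ∈ U i) ∧
      ∀ m, (∀ k < m, IsOpenOnCells O k) → ∀ b ∈ X.cells.skel m,
        ∀ a : 𝒱.toClosure.obj V ⟶ 𝒱.toClosure.obj (X.fiber b),
          (∀ i, X.pt b (closureLin a (v i)) ∈ U i) → a ∈ O b := by
  obtain ⟨N, U₀, hU₀, haU₀⟩ := exists_isOpenStage hv hO hb ha
  choose F hF hF' using fun (n : ℕ) (U : {U : ι → Set X.Total // IsOpenStage v O n U}) =>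
    U.2.exists_succ hv
  -- Stage `m` lives over `skel (N + m)`, and later stages do not change it there; the union thus
  -- has the stages as its traces.
  let u : ∀ m, {U : ι → Set X.Total // IsOpenStage v O (N + m) U} := fun m =>
    Nat.rec ⟨U₀, hU₀⟩ (fun m U => ⟨F (N + m) U, hF (N + m) U⟩) m
  have hu : ∀ m d i x, X.proj x ∈ X.cells.skel (N + m) →
      (x ∈ (u (m + d)).1 i ↔ x ∈ (u m).1 i) := by
    intro m d i x hx
    induction d with
    | zero => rfl
    | succ d ih =>
      rw [← ih]
      exact hF' (N + (m + d)) (u (m + d)) i x (X.skel_mono (by lia) hx)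
  have hmem : ∀ m i x, X.proj x ∈ X.cells.skel (N + m) →
      (x ∈ ⋃ m, (u m).1 i) → x ∈ (u m).1 i := by
    intro m i x hx h
    obtain ⟨m', hm'⟩ := Set.mem_iUnion.1 h
    rcases le_total m m' with h | h
    · obtain ⟨d, rfl⟩ := Nat.exists_eq_add_of_le h
      exact (hu m d i x hx).1 hm'
    · obtain ⟨d, rfl⟩ := Nat.exists_eq_add_of_le h
      exact (hu m' d i x ((u m').2.proj_mem i x hm')).2 hm'
  refine ⟨fun i => ⋃ m, (u m).1 i, fun i => isOpen_of_char fun k c => ?_,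
    fun i => Set.mem_iUnion.2 ⟨0, haU₀ i⟩, fun m hm b hb a ha => ?_⟩
  -- A `k`-cell lies over `skel (k + 1)`, so stage `k + 1` already determines the trace on it.
  · convert (u (k + 1)).2.isOpen i k (by lia) c using 1
    ext p
    refine ⟨hmem (k + 1) i _ ?_, fun h => Set.mem_iUnion.2 ⟨k + 1, h⟩⟩
    rw [proj_charFun]
    exact X.skel_mono (by lia) (charBase_mem_skel c p.1)
  · refine (u m).2.mem m (by lia) hm b hb a fun i => hmem m i _ ?_ (ha i)
    rw [X.proj_pt]
    exact X.skel_mono (by lia) hb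

end VComplex

/-! ## The topology of `ψX` -/

section PsiTopology

variable (ψ : 𝒱.Obj ⥤ 𝒲.Obj) (X : VComplex 𝒱)

/-- The map `ψ(V_c) × D^k → ψX` induced by the characteristic map of the cell `c`. -/
noncomputable def psiCell {k : ℕ} (c : X.cells.Cell k)
    (p : Disk k × ψ.obj (X.cells.cellFiber k c)) : PsiTotal ψ X.toPreFamily :=
  ⟨X.charBase c p.1, lin (ψ.map (X.charMor c p.1)) p.2⟩

/-- A zero vector is added at `none` so that the index type is nonempty even for `V = 0`; the open
stages need this. -/
theorem exists_spanning_family (V : FGModuleCat.{u} ℝ) : ∃ (ι : Type) (_ : Finite ι)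
    (_ : Nonempty ι) (v : ι → V), Submodule.span ℝ (Set.range v) = ⊤ := by
  obtain ⟨n, s, hs⟩ := Module.Finite.exists_fin (R := ℝ) (M := V)
  refine ⟨Option (Fin n), inferInstance, inferInstance, fun i => i.elim 0 s, ?_⟩
  rw [eq_top_iff, ← hs]
  exact Submodule.span_mono (Set.range_subset_iff.2 fun i => ⟨some i, rfl⟩)

/-- The tube lemma. -/
theorem isOpen_setOf_forall_mem_of_isCompact {Y Z : Type*} [TopologicalSpace Y]
    [TopologicalSpace Z] {B : Set Z} (hB : IsCompact B) {P : Set (Y × Z)} (hP : IsOpen P) :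
    IsOpen {y | ∀ z ∈ B, (y, z) ∈ P} :=
  isOpen_iff_eventually.2 fun _ hy =>
    hB.eventually_forall_of_forall_eventually fun z hz => hP.mem_nhds (hy z hz)

variable {ψ X}

/-- Each fibre is the fibre of a cell at an interior point, up to an isomorphism that `ψ` preserves.
-/
theorem isOpen_psi_fiber {O : Set (PsiTotal ψ X.toPreFamily)} {n : ℕ}
    (hO : ∀ k < n, ∀ c : X.cells.Cell k, IsOpen (psiCell ψ X c ⁻¹' O)) {b : X.Base}
    (hb : b ∈ X.cells.skel n) : IsOpen {w : ψ.obj (X.fiber b) | ⟨b, w⟩ ∈ O} := by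
  obtain ⟨k, hk, -, c, e, he, rfl⟩ := VComplex.exists_char_of_mem_skel hb
  have := VComplex.isIso_charMor (c := c) he
  have hc : Continuous fun w : ψ.obj (X.fiber (X.charBase c e)) =>
      (e, lin (inv (ψ.map (X.charMor c e))) w) :=
    continuous_const.prodMk (IsModuleTopology.continuous_of_linearMap _)
  convert (hO k hk c).preimage hc using 1
  ext w
  change _ ↔ (⟨X.charBase c e, lin (ψ.map (X.charMor c e))
    (lin (inv (ψ.map (X.charMor c e))) w)⟩ : PsiTotal ψ X.toPreFamily) ∈ O
  rw [PreMap.lin_apply_inv]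
  rfl

/-- Application of `ψ` to a continuous family of maps `V → X` gives a continuous family of maps
`ψ(V) → ψX`. -/
theorem isOpen_psi_preimage (E : ClosureExtension ψ) {T : Type*} [TopologicalSpace T]
    {V : 𝒱.Obj} {β : T → X.Base} {a : ∀ t, V ⟶ X.fiber (β t)}
    (ha : ∀ v : V, Continuous fun t => X.pt (β t) (lin (a t) v))
    {O : Set (PsiTotal ψ X.toPreFamily)}
    (hO : ∀ t, ∃ n, β t ∈ X.cells.skel n ∧
      ∀ k < n, ∀ c : X.cells.Cell k, IsOpen (psiCell ψ X c ⁻¹' O)) :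
    IsOpen {p : T × ψ.obj V | (⟨β p.1, lin (ψ.map (a p.1)) p.2⟩ : PsiTotal ψ X.toPreFamily) ∈ O} := by
  obtain ⟨ι, _, _, v, hv⟩ := exists_spanning_family V.vect
  rw [isOpen_iff_mem_nhds]
  rintro ⟨t₀, w₀⟩ h₀
  obtain ⟨n, hn, hOn⟩ := hO t₀
  obtain ⟨B, hB, hwB, hBO⟩ := exists_compact_subset ((isOpen_psi_fiber hOn hn).preimage
    (IsModuleTopology.continuous_of_linearMap (lin (ψ.map (a t₀))))) h₀
  -- Asking for all of the compact set `B`, and not only for `w₀`, makes `Q` open on cells and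
  -- yields a product neighbourhood at the end.
  let Q : ∀ b : X.Base, Set (𝒱.toClosure.obj V ⟶ 𝒱.toClosure.obj (X.fiber b)) := fun b =>
    {g | ∀ w ∈ B, (⟨b, E.E g w⟩ : PsiTotal ψ X.toPreFamily) ∈ O}
  have hQ : ∀ k, (∀ c : X.cells.Cell k, IsOpen (psiCell ψ X c ⁻¹' O)) →
      VComplex.IsOpenOnCells Q k := by
    intro k hk c
    have hc : Continuous fun p : (Disk k × (𝒱.toClosure.obj V ⟶
        𝒱.toClosure.obj (X.cells.cellFiber k c))) × ψ.obj V => (p.1.1, E.E p.1.2 p.2) :=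
      (continuous_fst.comp continuous_fst).prodMk ((E.continuous_E _ _).comp
        ((continuous_snd.comp continuous_fst).prodMk continuous_snd))
    convert isOpen_setOf_forall_mem_of_isCompact hB ((hk c).preimage hc) using 1
    ext p
    simp only [Q, Set.mem_ofPred_eq, E.E_comp]
    rfl
  have h₀Q : 𝒱.toClosure.map (a t₀) ∈ Q (β t₀) := by
    intro w hw
    rw [E.E_map]
    exact hBO hw
  obtain ⟨U, hU, haU, hUQ⟩ := VComplex.exists_isOpen_of_isOpenOnCells hv
    (fun k hk => hQ k (hOn k hk)) hn h₀Q
  -- Only finitely many values `a t (v i)` have to be controlled, so pointwise continuity in `t` is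
  -- enough.
  have hT : (⋂ i, (fun t => X.pt (β t) (lin (a t) (v i))) ⁻¹' U i) ∈ 𝓝 t₀ :=
    Filter.iInter_mem.2 fun i => ((hU i).preimage (ha (v i))).mem_nhds (haU i)
  filter_upwards [prod_mem_nhds hT (mem_interior_iff_mem_nhds.1 hwB)] with p hp
  obtain ⟨m, hm, hOm⟩ := hO p.1
  have h := hUQ m (fun k hk => hQ k (hOm k hk)) _ hm (𝒱.toClosure.map (a p.1))
    (fun i => Set.mem_iInter.1 hp.1 i) p.2 hp.2
  rw [E.E_map] at h
  exact h

/-! ### Skeleta of `ψX` as closed subspaces -/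

noncomputable instance psiSkelTopology (n : ℕ) : TopologicalSpace (PsiSkel ψ X n) :=
  psiSkelTop ψ X n

/-- The inclusion of a skeleton in `ψX`. -/
def psiSkelVal {n : ℕ} (x : PsiSkel ψ X n) : PsiTotal ψ X.toPreFamily := x.1

theorem psiSkelVal_injective {n : ℕ} :
    Function.Injective (psiSkelVal : PsiSkel ψ X n → PsiTotal ψ X.toPreFamily) :=
  fun _ _ => Subtype.ext

theorem isOpen_psiSkel_iff {n : ℕ} {O : Set (PsiTotal ψ X.toPreFamily)} :
    IsOpen (psiSkelVal ⁻¹' O : Set (PsiSkel ψ X n)) ↔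
      ∀ k < n, ∀ c : X.cells.Cell k, IsOpen (psiCell ψ X c ⁻¹' O) := by
  induction n with
  | zero => simp only [Nat.not_lt_zero, false_imp_iff, implies_true, iff_true]; exact trivial
  | succ n ih =>
    have h : IsOpen (psiSkelVal ⁻¹' O : Set (PsiSkel ψ X (n + 1))) ↔
        IsOpen (psiSkelVal ⁻¹' O : Set (PsiSkel ψ X n)) ∧ IsOpen (psiCharFun ψ X n ⁻¹' O) :=
      Iff.rfl
    rw [h, ih, Nat.forall_lt_succ_right]
    exact and_congr_right fun _ => isOpen_sigma_iff

theorem isOpen_psi_iff_skel {O : Set (PsiTotal ψ X.toPreFamily)} :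
    IsOpen O ↔ ∀ n, IsOpen (psiSkelVal ⁻¹' O : Set (PsiSkel ψ X n)) :=
  isOpen_iSup_iff

theorem isOpen_psi_iff {O : Set (PsiTotal ψ X.toPreFamily)} :
    IsOpen O ↔ ∀ k, ∀ c : X.cells.Cell k, IsOpen (psiCell ψ X c ⁻¹' O) := by
  rw [isOpen_psi_iff_skel]
  simp only [isOpen_psiSkel_iff]
  exact ⟨fun h k => h (k + 1) k k.lt_succ_self, fun h _ k _ => h k⟩

/-- The attaching map of `ψX`. -/
noncomputable def psiAttach (ψ : 𝒱.Obj ⥤ 𝒲.Obj) (X : VComplex 𝒱) (n : ℕ)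
    (s : (VFamily.cells (fun c => ψ.obj (X.cells.cellFiber n c)) (BdSphere n)).Total) :
    PsiSkel ψ X n :=
  ⟨psiCell ψ X s.1 (bdIncl n s.2.1, s.2.2), X.isComplex.attach_mem n ⟨s.1, s.2.1⟩⟩

theorem continuous_psiAttach (E : ClosureExtension ψ) (n : ℕ) :
    Continuous (psiAttach ψ X n) := by
  refine continuous_sigma fun c => ⟨fun U hU => ?_⟩
  -- An open set of the skeleton is regarded as a subset of `ψX`. It is known to be open only on
  -- cells below dimension `n`, which suffices because the attaching map lands over `skel n`.
  have hUO : (psiSkelVal ⁻¹' (psiSkelVal '' U) : Set (PsiSkel ψ X n)) = U :=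
    Set.preimage_image_eq _ psiSkelVal_injective
  rw [← hUO] at hU ⊢
  refine isOpen_psi_preimage (T := BdSphere n) E (β := fun s => X.charBase c (bdIncl n s))
    (a := fun s => X.charMor c (bdIncl n s)) (fun v => ?_)
    fun t => ⟨n, X.isComplex.attach_mem n ⟨c, t⟩, isOpen_psiSkel_iff.1 hU⟩
  exact ((VComplex.continuous_charFun c).comp ((bdIncl n).continuous.prodMk continuous_const)).congr
    fun s => VComplex.charFun_eq c (bdIncl n s, v)

theorem isClosedEmbedding_psiSkelIncl (E : ClosureExtension ψ) (n : ℕ) :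
    IsClosedEmbedding (psiSkelIncl ψ X n) := by
  refine isClosedEmbedding_of_glue (i := (cellsMap (fun c => ψ.obj (X.cells.cellFiber n c))
    (bdIncl n)).toFun) (h := psiAttach ψ X n) (φ := psiCharSkel ψ X n)
    (isClosedEmbedding_cellsMap_toFun _ n) (continuous_psiAttach E n)
    (fun x y h => psiSkelVal_injective (congrArg (fun z => z.1) h)) (fun s => rfl) (fun z x h => ?_) rfl
  have h' : X.charBase z.1 z.2.1 = x.1.1 := congrArg (fun y => y.1.1) h
  rw [mem_range_cellsMap_toFun, ← VComplex.charBase_mem_skel_iff (c := z.1), h']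
  exact x.2

/-- The inclusion of skeleta of `ψX`. -/
def psiSkelLE (ψ : 𝒱.Obj ⥤ 𝒲.Obj) (X : VComplex 𝒱) {m n : ℕ} (h : m ≤ n) (x : PsiSkel ψ X m) :
    PsiSkel ψ X n := ⟨x.1, X.skel_mono h x.2⟩

theorem isClosedEmbedding_psiSkelLE (E : ClosureExtension ψ) {m n : ℕ} (h : m ≤ n) :
    IsClosedEmbedding (psiSkelLE ψ X h) := by
  induction n, h using Nat.le_induction with
  | base => exact IsClosedEmbedding.id
  | succ n h ih => exact (isClosedEmbedding_psiSkelIncl E n).comp ih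

/-- A closed set in one skeleton has closed trace in every other: a preimage in lower skeleta, an
image under a closed embedding in higher ones. -/
theorem isClosedEmbedding_psiSkel (E : ClosureExtension ψ) (n : ℕ) :
    IsClosedEmbedding (psiSkelVal : PsiSkel ψ X n → PsiTotal ψ X.toPreFamily) := by
  refine IsClosedEmbedding.of_continuous_injective_isClosedMap
    ⟨fun O hO => isOpen_psi_iff_skel.1 hO n⟩ psiSkelVal_injective fun F hF => ?_
  rw [← isOpen_compl_iff, isOpen_psi_iff_skel]
  intro m
  rw [Set.preimage_compl, isOpen_compl_iff]
  rcases le_total m n with h | h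
  · convert hF.preimage (isClosedEmbedding_psiSkelLE E h).continuous using 1
    ext x
    constructor
    · rintro ⟨y, hy, hxy⟩
      rwa [Set.mem_preimage, show psiSkelLE ψ X h x = y from Subtype.ext hxy.symm]
    · exact fun hx => ⟨_, hx, rfl⟩
  · convert (isClosedEmbedding_psiSkelLE E h).isClosedMap F hF using 1
    ext x
    constructor
    · rintro ⟨y, hy, hxy⟩
      exact ⟨y, hy, Subtype.ext hxy⟩
    · rintro ⟨y, hy, rfl⟩
      exact ⟨y, hy, rfl⟩

/-- The topology of the skeleta of `ψX` is the subspace topology. -/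
theorem psiSkelTop_eq_induced (E : ClosureExtension ψ) (n : ℕ) :
    psiSkelTop ψ X n = TopologicalSpace.induced Subtype.val (psiTop ψ X) :=
  (isClosedEmbedding_psiSkel E n).isInducing.eq_induced

end PsiTopology

/-! ## `ψX` as a complex -/

/-- A complex is a family if its skeleta are. -/
theorem isFamily_of_restrictPre {X : PreFamily 𝒱} (hX : Continuous X.proj)
    (h : ∀ b, ∃ S : Set X.Base, b ∈ S ∧ (restrictPre X S).IsFamily) : X.IsFamily := by
  refine PreFamily.isFamily_iff.2 ⟨hX, fun b => ?_⟩
  obtain ⟨S, hb, hS⟩ := h b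
  obtain ⟨h₁, h₂⟩ := (PreFamily.isFamily_iff.1 hS).2 ⟨b, hb⟩
  have h₃ : Continuous fun v => ((restrictPre X S).pt ⟨b, hb⟩ v).1 :=
    Continuous.comp (g := fun y : (restrictPre X S).Total => y.1) continuous_subtype_val h₂
  refine ⟨?_, h₃⟩
  let r : {x : X.Total // X.proj x = b} →
      {x : (restrictPre X S).Total // (restrictPre X S).proj x = ⟨b, hb⟩} :=
    fun x => ⟨⟨x.1, Set.mem_of_eq_of_mem x.2 hb⟩, Subtype.ext x.2⟩
  have hr : Continuous r :=
    continuous_induced_rng.2 (continuous_induced_rng.2 continuous_subtype_val)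
  exact h₁.comp hr

section PsiComplex

variable {ψ : 𝒱.Obj ⥤ 𝒲.Obj}

theorem psiChar_fiberMap (X : VComplex 𝒱) (n : ℕ)
    (p : (VFamily.cells (fun c => ψ.obj (X.cells.cellFiber n c)) (Disk n)).Base) :
    (psiChar ψ X n).fiberMap p = ψ.map (X.charMor p.1 p.2) :=
  PreMap.fiberMap_eq (psiChar ψ X n) (m := ψ.map (X.charMor p.1 p.2)) fun _ => rfl

/-- Base conditions are those of `X`, and `ψ` preserves the fibre isomorphisms. The total space
carries the inductive push-out topology, which agrees with the subspace topologies used by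
`restrictPre`. -/
theorem isGlued_psi (E : ClosureExtension ψ) (X : VComplex 𝒱) (n : ℕ) :
    IsGlued (restrictIncl (psiFamily ψ X) (X.isComplex.skel_succ n))
      ((psiChar ψ X n).lift (X.cells.skel (n + 1)) (X.isComplex.char_mem n)) where
  base_injective := (X.isGlued n).base_injective
  isIso_fiberMap b := by
    have h : (restrictIncl (psiFamily ψ X) (X.isComplex.skel_succ n)).fiberMap b =
      𝟙 (ψ.obj (X.fiber b.1)) := restrictIncl_fiberMap _ b
    exact (congrArg (fun m => IsIso m) h).mpr (inferInstanceAs (IsIso (𝟙 (ψ.obj (X.fiber b.1)))))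
  char_injective := (X.isGlued n).char_injective
  isIso_char p hp := by
    have := VComplex.isIso_charMor (c := p.1) hp
    exact (congrArg (fun m => IsIso m) (psiChar_fiberMap X n p)).mpr
      (inferInstanceAs (IsIso (ψ.map (X.charMor p.1 p.2))))
  char_mem_range := (X.isGlued n).char_mem_range
  cover := (X.isGlued n).cover
  topTotal_eq := by
    have h : psiSkelTop ψ X (n + 1) = (psiSkelTop ψ X n).coinduced (psiSkelIncl ψ X n) ⊔
      TopologicalSpace.coinduced (psiCharSkel ψ X n) inferInstance := rfl
    rw [psiSkelTop_eq_induced E n, psiSkelTop_eq_induced E (n + 1)] at h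
    exact h
  topBase_eq := (X.isGlued n).topBase_eq

/-- The attaching map of `ψX`, as a map of families. -/
noncomputable def psiAttachMap (ψ : 𝒱.Obj ⥤ 𝒲.Obj) (X : VComplex 𝒱) (n : ℕ) :
    PreMap (VFamily.cells (fun c => ψ.obj (X.cells.cellFiber n c)) (BdSphere n)).toPreFamily
      (restrictPre (psiFamily ψ X) (X.cells.skel n)) :=
  ((cellsMap (fun c => ψ.obj (X.cells.cellFiber n c)) (bdIncl n)).toPreMap.comp
    (psiChar ψ X n)).lift (X.cells.skel n) (X.isComplex.attach_mem n)

theorem psiAttachMap_isContinuous (E : ClosureExtension ψ) (X : VComplex 𝒱) (n : ℕ) :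
    (psiAttachMap ψ X n).IsContinuous where
  continuous_toFun := by
    have h := continuous_psiAttach (X := X) E n
    exact continuous_induced_rng.2 ((isClosedEmbedding_psiSkel E n).continuous.comp h)
  continuous_base := by
    have h := (X.isComplex.char_continuous n).2.comp
      (cellsMap (X.cells.cellFiber n) (bdIncl n)).isContinuous.2
    exact h.subtype_mk _

theorem psiAttachMap_comm (X : VComplex 𝒱) (n : ℕ) :
    (psiAttachMap ψ X n).comp (restrictIncl (psiFamily ψ X) (X.isComplex.skel_succ n)) =
      (cellsMap (fun c => ψ.obj (X.cells.cellFiber n c)) (bdIncl n)).toPreMap.comp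
        ((psiChar ψ X n).lift (X.cells.skel (n + 1)) (X.isComplex.char_mem n)) := rfl

theorem restrictPre_psiFamily_isFamily (E : ClosureExtension ψ) (X : VComplex 𝒱) (n : ℕ) :
    (restrictPre (psiFamily ψ X) (X.cells.skel n)).IsFamily := by
  induction n with
  | zero =>
    have h : X.cells.skel 0 → False := fun b =>
      Set.notMem_empty b.1 (Set.mem_of_mem_of_subset b.2 X.isComplex.skel_zero.subset)
    exact ⟨continuous_of_const fun x => (h ((restrictPre (psiFamily ψ X) _).proj x)).elim,
      fun b => (h b).elim⟩
  | succ n ih =>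
    exact (isGlued_psi E X n).isFamily ih (psiAttachMap_isContinuous E X n)
      (psiAttachMap_comm X n)

theorem psiChar_isContinuous (X : VComplex 𝒱) (n : ℕ) : (psiChar ψ X n).IsContinuous where
  continuous_toFun := continuous_sigma fun c => ⟨fun _ hO => isOpen_psi_iff.1 hO n c⟩
  continuous_base := (X.isComplex.char_continuous n).2

theorem psiFamily_isFamily (E : ClosureExtension ψ) (X : VComplex 𝒱) :
    (psiFamily ψ X).IsFamily := by
  refine isFamily_of_restrictPre ⟨fun U hU => isOpen_psi_iff.2 fun k c => ?_⟩ fun b => ?_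
  · exact (hU.preimage (X.isComplex.char_continuous k).2).preimage
      ((continuous_sigmaMk (σ := fun _ : X.cells.Cell k => Disk k) (i := c)).comp continuous_fst)
  · obtain ⟨n, hn⟩ := X.exists_mem_skel b
    exact ⟨_, hn, restrictPre_psiFamily_isFamily E X n⟩

theorem psiCells_isComplex (E : ClosureExtension ψ) (X : VComplex 𝒱) :
    (psiCells ψ X).IsComplex where
  isFamily := psiFamily_isFamily E X
  skel_zero := X.isComplex.skel_zero
  skel_succ := X.isComplex.skel_succ
  iUnion_skel := X.isComplex.iUnion_skel
  char_continuous := psiChar_isContinuous X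
  char_mem := X.isComplex.char_mem
  attach_mem := X.isComplex.attach_mem
  isPushout n := IsGlued.isPushout (isGlued_psi E X n) rfl
  isClosed_base := X.isComplex.isClosed_base
  isClosed_total S hS := by
    rw [← isOpen_compl_iff]
    refine isOpen_psi_iff_skel.2 fun n => ?_
    have h := (hS n).isOpen_compl
    have e := psiSkelTop_eq_induced (X := X) E n
    change IsOpen[psiSkelTop ψ X n] _
    rw [e]
    exact h

/-! ### Continuity and functoriality of `ψ` on maps -/

theorem map_comp_apply (ψ : 𝒱.Obj ⥤ 𝒲.Obj) {U V W : 𝒱.Obj} (f : U ⟶ V) (g : V ⟶ W)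
    (w : ψ.obj U) : lin (ψ.map (f ≫ g)) w = lin (ψ.map g) (lin (ψ.map f) w) := by
  rw [ψ.map_comp]
  rfl

/-- Tested on a cell, this is the key continuity statement with the disk as parameter space and the
fibre morphisms of `f` after the characteristic map. -/
theorem psiMap_isContinuous (E : ClosureExtension ψ) {X Y : VComplex 𝒱} (f : X ⟶ Y) :
    (psiMap ψ f).IsContinuous where
  continuous_toFun := by
    refine ⟨fun O hO => isOpen_psi_iff.2 fun k c => ?_⟩
    have h := isOpen_psi_preimage (X := Y) (T := Disk k) E
      (β := fun e => (VMap.toPreMap f).base (X.charBase c e))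
      (a := fun e => X.charMor c e ≫ (VMap.toPreMap f).fiberMap (X.charBase c e)) (fun v => ?_)
      (O := O) fun t => ?_
    · convert h using 1
      ext p
      exact (congrArg (fun w => (⟨_, w⟩ : PsiTotal ψ Y.toPreFamily) ∈ O)
        (map_comp_apply ψ (X.charMor c p.1) _ p.2)).symm ▸ Iff.rfl
    · refine ((VMap.isContinuous f).1.comp ((VComplex.continuous_charFun c).comp
        (continuous_id.prodMk continuous_const : Continuous fun e => (e, v)))).congr fun e => ?_
      change (VMap.toPreMap f).toFun (X.charFun c (e, v)) = _
      rw [VComplex.charFun_eq]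
      exact (VMap.toPreMap f).toFun_pt _ _
    · obtain ⟨n, hn⟩ := Y.exists_mem_skel ((VMap.toPreMap f).base (X.charBase c t))
      exact ⟨n, hn, fun k _ => isOpen_psi_iff.1 hO k⟩
  continuous_base := (VMap.isContinuous f).2

/-- By currying, joint continuity on `X^V × ψV` is enough, and the key statement uses only that
evaluation at each vector is continuous on `X^V`. -/
theorem continuous_psiHat (E : ClosureExtension ψ) (X : VComplex 𝒱) (V : 𝒱.Obj) :
    Continuous (psiHat ψ X (psiFamily_isFamily E X) V) := by
  refine continuous_induced_rng.2 (ContinuousMap.continuous_of_continuous_uncurry _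
    ⟨fun O hO => ?_⟩)
  refine isOpen_psi_preimage (X := X) (T := FunSpace V X.toVFamily) E
    (β := fun a => (VMap.toPreMap a).base PUnit.unit)
    (a := fun a => (VMap.toPreMap a).fiberMap PUnit.unit) (fun v => ?_) (O := O) fun a => ?_
  · have h : Continuous fun a : FunSpace V X.toVFamily => a.toContinuousMap v :=
      (ContinuousEvalConst.continuous_eval_const v).comp continuous_induced_dom
    exact h.congr fun a => (VMap.toPreMap a).toFun_pt PUnit.unit v
  · obtain ⟨n, hn⟩ := X.exists_mem_skel ((VMap.toPreMap a).base PUnit.unit)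
    exact ⟨n, hn, fun k _ => isOpen_psi_iff.1 hO k⟩

theorem psiFun_id (X : VComplex 𝒱) (x : PsiTotal ψ X.toPreFamily) :
    psiFun ψ (PreMap.id X.toPreFamily) x = x := by
  obtain ⟨b, w⟩ := x
  change (⟨b, lin (ψ.map ((PreMap.id X.toPreFamily).fiberMap b)) w⟩ :
    PsiTotal ψ X.toPreFamily) = ⟨b, w⟩
  rw [PreMap.id_fiberMap]
  exact congrArg (fun m => (⟨b, lin m w⟩ : PsiTotal ψ X.toPreFamily)) (ψ.map_id _)

theorem psiFun_comp {X Y Z : PreFamily 𝒱} (f : PreMap X Y) (g : PreMap Y Z) (x : PsiTotal ψ X) :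
    psiFun ψ (f.comp g) x = psiFun ψ g (psiFun ψ f x) := by
  obtain ⟨b, w⟩ := x
  change (⟨g.base (f.base b), lin (ψ.map ((f.comp g).fiberMap b)) w⟩ : PsiTotal ψ Z) =
    ⟨g.base (f.base b), lin (ψ.map (g.fiberMap (f.base b))) (lin (ψ.map (f.fiberMap b)) w)⟩
  rw [PreMap.comp_fiberMap]
  exact congrArg (Sigma.mk _) (map_comp_apply ψ _ _ w)

/-- The functor `X ↦ ψX` on complexes. -/
noncomputable def psiFunctor (E : ClosureExtension ψ) : VComplex 𝒱 ⥤ VComplex 𝒲 where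
  obj X := psiComplex ψ X (psiCells_isComplex E X)
  map f := psiHom ψ f _ _ (psiMap_isContinuous E f)
  map_id X := VMap.ext_toPreMap (PreMap.ext_toFun (psiFun_id X))
  map_comp f g := VMap.ext_toPreMap (PreMap.ext_toFun
    (psiFun_comp (VMap.toPreMap f) (VMap.toPreMap g)))

end PsiComplex

/-! ### The main theorem -/

theorem mainTheorem6 {𝒱 𝒲 : StructureCategory.{u}} (ψ : 𝒱.Obj ⥤ 𝒲.Obj)
    (hψ : IsContinuousFunctor ψ)
    (hreg : (𝒱.IsClosedSubcategory ∧ 𝒲.IsClosedSubcategory) ∨ IsRegularFunctor ψ) :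
    ∃ (hobj : ∀ X : VComplex 𝒱, (psiCells ψ X).IsComplex)
      (hmap : ∀ {X Y : VComplex 𝒱} (f : X ⟶ Y), (psiMap ψ f).IsContinuous),
      (∃ (Ψ : VComplex 𝒱 ⥤ VComplex 𝒲)
        (e : ∀ X : VComplex 𝒱, Ψ.obj X = psiComplex ψ X (hobj X)),
        ∀ {X Y : VComplex 𝒱} (f : X ⟶ Y),
          Ψ.map f = eqToHom (e X) ≫ psiHom ψ f (hobj X) (hobj Y) (hmap f) ≫
            eqToHom (e Y).symm) ∧
      (∀ (X : VComplex 𝒱) (n : ℕ),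
        psiSkelTop ψ X n = TopologicalSpace.induced Subtype.val (psiTop ψ X)) ∧
      (∀ (X : VComplex 𝒱) (V : 𝒱.Obj), Continuous (psiHat ψ X (hobj X).isFamily V)) := by
  obtain ⟨E⟩ := nonempty_closureExtension hψ hreg
  refine ⟨psiCells_isComplex E, psiMap_isContinuous E, ⟨psiFunctor E, fun X => rfl, fun f => ?_⟩,
    fun X n => psiSkelTop_eq_induced E n, continuous_psiHat E⟩
  -- The object equalities hold by `rfl`, so both `eqToHom` factors are identities.
  exact ((Category.id_comp _).trans (Category.comp_id _)).symm
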